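/- Let $d\ge 1$, $M\ge 2$, and let $T_1,\dots,T_M$ be non-singular linear maps on $\mathbb{R}^d$ with operator norms $\|T_j\|<\tfrac12$ (with respect to the Euclidean norm) for $1\le j\le M$. For $\mathbf a=(a_1,\dots,a_M)\in\mathbb{R}^{Md}$ let $E^{\mathbf a}$ be the self-affine set with translations $\mathbf a$, that is, the unique non-empty compact set with $E^{\mathbf a}=\bigcup_{i=1}^M (T_i(E^{\mathbf a})+a_i)$. For a non-singular linear map $T$ with singular values $\alpha_1\ge\dots\ge\alpha_d>0$ put $\phi^0(T)=1$; $\phi^s(T)=\alpha_1\cdots\alpha_{m-1}\alpha_m^{\,s-m+1}$ if $0<s\le d$, where $m$ is the integer with $m-1<s\le m$; and $\phi^s(T)=(\alpha_1\cdots\alpha_d)^{s/d}$ if $s>d$. For a finite word $\mathbf u=u_1\cdots u_k$ over $\{1,\dots,M\}$ write $|\mathbf u|=k$, $T_{\mathbf u}=T_{u_1}\cdots T_{u_k}$, and let $\mathcal C_{\mathbf u}$ be the set of all infinite words in $\Sigma^\infty=\{1,\dots,M\}^{\mathbb N}$ that begin with $\mathbf u$. For $s\ge 0$ and $G\subseteq\Sigma^\infty$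 let $$\mathcal M^s(G)=\lim_{k\to\infty}\ \inf\Big\{\sum_{\mathbf u\in A}\phi^s(T_{\mathbf u}) : G\subseteq\bigcup_{\mathbf u\in A}\mathcal C_{\mathbf u},\ |\mathbf u|\ge k \text{ for all } \mathbf u\in A\Big\},$$ $$s_A=\inf\{s\ge 0:\mathcal M^s(\Sigma^\infty)=0\}.$$ Then $s_A$ is well defined and $s_A=\sup\{s\ge0:\mathcal M^s(\Sigma^\infty)=\infty\}$; moreover $s_A$ is equal to the affinity dimension of $(T_1,\dots,T_M)$, that is, it is the unique $s\ge 0$ with $$\lim_{k\to\infty}\Big(\sum_{|\mathbf u|=k}\phi^s(T_{\mathbf u})\Big)^{1/k}=1 .$$ For every $\mathbf a\in\mathbb{R}^{Md}$ the self-affine set $E^{\mathbf a}$ exists and is unique, and for $\mathcal L^{Md}$-almost every $\mathbf a\in\mathbb{R}^{Md}$: 1. $\dim_{\rm H}E^{\mathbf a}=s_A$ if $s_A\le d$; 2. $\mathcal L^d(E^{\mathbf a})>0$ if $s_A>d$. -/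

import Mathlib

open Set Filter Topology MeasureTheory
open scoped ENNReal

namespace SelfAffine

/-- `ℝ^d` with the Euclidean norm. -/
abbrev E (d : ℕ) : Type := EuclideanSpace ℝ (Fin d)

/-- `F` is an attractor of the self-affine iterated function system `Ψ_i(x) = T_i x + a_i`:
a non-empty compact set with `F = ⋃ i, Ψ_i(F)`. -/
def IsAttractor {d M : ℕ} (T : Fin M → (E d →L[ℝ] E d)) (a : Fin M → E d) (F : Set (E d)) :
    Prop :=
  F.Nonempty ∧ IsCompact F ∧ F = ⋃ i : Fin M, (fun x => T i x + a i) '' F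

/-- The `i`-th singular value of `T`, numbered from zero and listed in decreasing order: the
number usually written `α_{i+1}(T)`. -/
noncomputable def singVal {d : ℕ} (T : E d →L[ℝ] E d) (i : ℕ) : ℝ :=
  (T : E d →ₗ[ℝ] E d).singularValues i

/-- The singular value function `φ^s(T)`, for `s ≥ 0`:
`φ^0(T) = 1`; `φ^s(T) = α_1 ⋯ α_{m-1} α_m^{s-m+1}` for `0 < s ≤ d`, where `m = ⌈s⌉` is the integer
with `m - 1 < s ≤ m`; and `φ^s(T) = (α_1 ⋯ α_d)^{s/d}` for `s > d`. -/
noncomputable def svf {d : ℕ} (s : ℝ) (T : E d →L[ℝ] E d) : ℝ :=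
  if s ≤ 0 then 1
  else if s ≤ d then
    (∏ i ∈ Finset.range (⌈s⌉₊ - 1), singVal T i) * singVal T (⌈s⌉₊ - 1) ^ (s - (⌈s⌉₊ : ℝ) + 1)
  else (∏ i ∈ Finset.range d, singVal T i) ^ (s / (d : ℝ))

/-- `T_u = T_{u_1} T_{u_2} ⋯ T_{u_k}` for a finite word `u = u_1 u_2 ⋯ u_k`
(the identity for the empty word; multiplication is composition). -/
noncomputable def wordMap {d M : ℕ} (T : Fin M → (E d →L[ℝ] E d)) (u : List (Fin M)) :
    E d →L[ℝ] E d :=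
  (u.map T).prod

/-- The cylinder of the finite word `u`: all infinite words that begin with `u`. -/
def cylinder {M : ℕ} (u : List (Fin M)) : Set (ℕ → Fin M) :=
  {v | ∀ (i : ℕ) (hi : i < u.length), v i = u[i]}

/-- `𝓜^s_{(k)}(G)`: the infimum of `∑ φ^s(T_u)` over all covers of `G` by cylinders of words `u`
of length at least `k`. -/
noncomputable def netPremeasure {d M : ℕ} (T : Fin M → (E d →L[ℝ] E d)) (s : ℝ) (k : ℕ)
    (G : Set (ℕ → Fin M)) : ℝ≥0∞ :=
  ⨅ A ∈ {A : Set (List (Fin M)) | (∀ u ∈ A, k ≤ u.length) ∧ G ⊆ ⋃ u ∈ A, cylinder u},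
    ∑' u : A, ENNReal.ofReal (svf s (wordMap T u))

/-- The net measure `𝓜^s(G) = lim_{k → ∞} 𝓜^s_{(k)}(G)`; as `𝓜^s_{(k)}(G)` is nondecreasing in
`k`, the limit is the supremum. -/
noncomputable def netMeasure {d M : ℕ} (T : Fin M → (E d →L[ℝ] E d)) (s : ℝ)
    (G : Set (ℕ → Fin M)) : ℝ≥0∞ :=
  ⨆ k : ℕ, netPremeasure T s k G

/-- The critical value `s_A = inf {s ≥ 0 : 𝓜^s(Σ^∞) = 0}`. -/
noncomputable def sA {d M : ℕ} (T : Fin M → (E d →L[ℝ] E d)) : ℝ :=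
  sInf {s : ℝ | 0 ≤ s ∧ netMeasure T s univ = 0}

/-- `s` solves the equation `lim_{k → ∞} (∑_{|u| = k} φ^s(T_u))^{1/k} = 1` whose unique solution
`s ≥ 0` is the affinity dimension of `(T_1, …, T_M)`. -/
def IsAffinityDim {d M : ℕ} (T : Fin M → (E d →L[ℝ] E d)) (s : ℝ) : Prop :=
  0 ≤ s ∧
    Tendsto (fun k : ℕ => (∑ u : Fin k → Fin M, svf s (wordMap T (List.ofFn u))) ^ (1 / (k : ℝ)))
      atTop (𝓝 1)

end SelfAffine

/-!
Submultiplicativity of `φ^s` makes the growth rate of `∑_{|u| = k} φ^s(T_u)` exist, and the bound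
`φ^t(T) ≤ φ^s(T) ‖T‖^(t-s)` makes it strictly decreasing in `s`. A finite net cover of `Σ^∞` of
total `φ^s`-weight less than one can be iterated, which forces the growth rate below one; hence
`s_A` is where the growth rate crosses one.

For the upper bound on the dimension, each `T_u(B)` is an ellipsoid, which is cut into boxes of side
its `m`-th semi-axis. For the lower bound, a Frostman measure on `Σ^∞` with
`μ(C_u) ≲ φ^s(T_u)` is pushed forward by the coding map `π_a`. If `v` and `w` first differ at place
`n`, then `π_a(v) - π_a(w)` is `T_{v|n}` applied to a linear function of `a`, in which the
coefficient of one of the translations differs from `±id` by an operator of norm less than one.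
The volume of the bounded `a` with `|π_a(v) - π_a(w)| ≤ r` is therefore `≲ r^t / φ^t(T_{v|n})`, and
integrating over `a` bounds the expected energy of the projected measure. Finite `t`-energy gives
the dimension, and `r^{-d} ∫ ν(B(x, r)) dν(x)` bounded along a sequence `r → 0` gives positive
volume, by Cauchy–Schwarz applied to `x ↦ ν(B(x, r))`.
-/

namespace SelfAffine

section SingularValues

variable {V W X : Type*} [NormedAddCommGroup V] [InnerProductSpace ℝ V]

theorem inner_self_apply_eq_sum_of_apply_eq_smul {ι : Type*} [Fintype ι]
    {e : OrthonormalBasis ι ℝ V} {A : V →ₗ[ℝ] V} {μ : ι → ℝ} (h : ∀ i, A (e i) = μ i • e i)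
    (x : V) : inner ℝ x (A x) = ∑ i, μ i * e.repr x i ^ 2 := by
  conv_lhs => rw [← e.sum_repr x, map_sum, e.sum_repr x, inner_sum]
  refine Finset.sum_congr rfl fun i _ => ?_
  rw [map_smul, h, inner_smul_right, inner_smul_right, real_inner_comm, ← e.repr_apply_apply]
  ring

variable [FiniteDimensional ℝ V]
  [NormedAddCommGroup W] [InnerProductSpace ℝ W] [FiniteDimensional ℝ W]
  [NormedAddCommGroup X] [InnerProductSpace ℝ X] [FiniteDimensional ℝ X]

/-- An orthonormal basis of right singular vectors of `T`, listed in the order of the singular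
values. -/
def IsRightSingularBasis {n : ℕ} (T : V →ₗ[ℝ] W) (e : OrthonormalBasis (Fin n) ℝ V) : Prop :=
  ∀ i : Fin n, (T.adjoint ∘ₗ T) (e i) = T.singularValues i ^ 2 • e i

theorem exists_isRightSingularBasis (T : V →ₗ[ℝ] W) {n : ℕ} (hn : Module.finrank ℝ V = n) :
    ∃ e : OrthonormalBasis (Fin n) ℝ V, IsRightSingularBasis T e := by
  refine ⟨T.isSymmetric_adjoint_comp_self.eigenvectorBasis hn, fun i => ?_⟩
  rw [T.sq_singularValues_fin hn i]
  exact T.isSymmetric_adjoint_comp_self.apply_eigenvectorBasis hn i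

theorem IsRightSingularBasis.norm_sq_apply {n : ℕ} {T : V →ₗ[ℝ] W}
    {e : OrthonormalBasis (Fin n) ℝ V} (he : IsRightSingularBasis T e) (x : V) :
    ‖T x‖ ^ 2 = ∑ i : Fin n, T.singularValues i ^ 2 * e.repr x i ^ 2 := by
  rw [← inner_self_apply_eq_sum_of_apply_eq_smul he, LinearMap.comp_apply,
    LinearMap.adjoint_inner_right, real_inner_self_eq_norm_sq]

theorem IsRightSingularBasis.norm_apply {n : ℕ} {T : V →ₗ[ℝ] W}
    {e : OrthonormalBasis (Fin n) ℝ V} (he : IsRightSingularBasis T e) (i : Fin n) :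
    ‖T (e i)‖ = T.singularValues i := by
  rw [← sq_eq_sq₀ (norm_nonneg _) (T.singularValues_nonneg i), he.norm_sq_apply,
    Finset.sum_eq_single i (fun j _ hj => by simp [hj]) (by simp)]
  simp

theorem singularValues_le_opNorm (T : V →L[ℝ] W) (i : ℕ) :
    (T : V →ₗ[ℝ] W).singularValues i ≤ ‖T‖ := by
  obtain hi | hi := lt_or_ge i (Module.finrank ℝ V)
  · obtain ⟨e, he⟩ := exists_isRightSingularBasis (T : V →ₗ[ℝ] W) rfl
    rw [← he.norm_apply ⟨i, hi⟩]
    simpa using T.le_opNorm (e ⟨i, hi⟩)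
  · rw [LinearMap.singularValues_of_finrank_le _ hi]
    exact norm_nonneg _

theorem inner_exteriorPowerMap (m : ℕ) (T : V →ₗ[ℝ] W) (x y : ⋀[ℝ]^m V) :
    inner ℝ (exteriorPower.map m T x) (exteriorPower.map m T y) =
      inner ℝ x (exteriorPower.map m (T.adjoint ∘ₗ T) y) := by
  let b := ((stdOrthonormalBasis ℝ V).exteriorPower m).toBasis
  have eq_on_basis : (innerₗ _).compl₁₂ (exteriorPower.map m T) (exteriorPower.map m T) =
      (innerₗ (⋀[ℝ]^m V)).compl₁₂ LinearMap.id (exteriorPower.map m (T.adjoint ∘ₗ T)) := by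
    refine LinearMap.ext_basis b b fun i j => ?_
    simp only [b, OrthonormalBasis.toBasis_exteriorPower, exteriorPower.basis_apply,
      exteriorPower.ιMulti_family, LinearMap.compl₁₂_apply, innerₗ_apply_apply,
      exteriorPower.map_apply_ιMulti, LinearMap.id_apply, exteriorPower.inner_ιMulti_ιMulti]
    congr 1
    ext a c
    simp [LinearMap.adjoint_inner_right]
  simpa using congrArg (fun f => f x y) eq_on_basis

theorem exteriorPowerMap_orthonormalBasis_of_apply_eq_smul {n : ℕ}
    {e : OrthonormalBasis (Fin n) ℝ V} {A : V →ₗ[ℝ] V} {μ : Fin n → ℝ}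
    (h : ∀ i, A (e i) = μ i • e i) (m : ℕ) (s : Set.powersetCard (Fin n) m) :
    exteriorPower.map m A (e.exteriorPower m s) =
      (∏ i, μ (Set.powersetCard.ofFinEmbEquiv.symm s i)) • e.exteriorPower m s := by
  have basis_apply : e.exteriorPower m s =
      exteriorPower.ιMulti ℝ m (e ∘ Set.powersetCard.ofFinEmbEquiv.symm s) := by
    rw [← OrthonormalBasis.coe_toBasis, OrthonormalBasis.toBasis_exteriorPower,
      exteriorPower.basis_apply]
    simp [exteriorPower.ιMulti_family]
  rw [basis_apply, exteriorPower.map_apply_ιMulti, ← AlternatingMap.map_smul_univ]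
  exact congrArg _ (funext fun i => h _)

theorem IsRightSingularBasis.norm_sq_exteriorPowerMap {n : ℕ} {T : V →ₗ[ℝ] W}
    {e : OrthonormalBasis (Fin n) ℝ V} (he : IsRightSingularBasis T e) (m : ℕ) (x : ⋀[ℝ]^m V) :
    ‖exteriorPower.map m T x‖ ^ 2 = ∑ s : Set.powersetCard (Fin n) m,
      (∏ i, T.singularValues (Set.powersetCard.ofFinEmbEquiv.symm s i)) ^ 2 *
        (e.exteriorPower m).repr x s ^ 2 := by
  rw [← real_inner_self_eq_norm_sq, inner_exteriorPowerMap,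
    inner_self_apply_eq_sum_of_apply_eq_smul
      (exteriorPowerMap_orthonormalBasis_of_apply_eq_smul he m)]
  simp only [Finset.prod_pow]

theorem val_le_apply_of_orderEmbedding {m n : ℕ} (f : Fin m ↪o Fin n) (i : Fin m) :
    (i : ℕ) ≤ f i := by
  simpa using Finset.card_le_card_of_injOn f (s := Finset.Iio i) (t := Finset.Iio (f i))
    (fun j hj => by simpa using hj) f.injective.injOn

theorem norm_exteriorPowerMap_le (m : ℕ) (T : V →ₗ[ℝ] W) (x : ⋀[ℝ]^m V) :
    ‖exteriorPower.map m T x‖ ≤ (∏ i ∈ Finset.range m, T.singularValues i) * ‖x‖ := by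
  obtain ⟨e, he⟩ := exists_isRightSingularBasis T rfl
  have prod_nonneg : 0 ≤ ∏ i ∈ Finset.range m, T.singularValues i :=
    Finset.prod_nonneg fun i _ => T.singularValues_nonneg i
  refine le_of_sq_le_sq ?_ (mul_nonneg prod_nonneg (norm_nonneg _))
  rw [he.norm_sq_exteriorPowerMap, mul_pow, ← (e.exteriorPower m).repr.norm_map x,
    EuclideanSpace.norm_sq_eq, Finset.mul_sum]
  simp only [Real.norm_eq_abs, sq_abs]
  gcongr with s _
  · exact Finset.prod_nonneg fun i _ => T.singularValues_nonneg _
  · rw [← Fin.prod_univ_eq_prod_range]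
    exact Finset.prod_le_prod (fun i _ => T.singularValues_nonneg _)
      fun i _ => T.singularValues_antitone (val_le_apply_of_orderEmbedding _ i)

theorem exists_norm_exteriorPowerMap_eq (T : V →ₗ[ℝ] W) {m : ℕ} (hm : m ≤ Module.finrank ℝ V) :
    ∃ x : ⋀[ℝ]^m V, ‖x‖ = 1 ∧
      ‖exteriorPower.map m T x‖ = ∏ i ∈ Finset.range m, T.singularValues i := by
  obtain ⟨e, he⟩ := exists_isRightSingularBasis T rfl
  let s := Set.powersetCard.ofFinEmbEquiv (Fin.castLEOrderEmb hm)
  refine ⟨e.exteriorPower m s, by simp, ?_⟩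
  rw [← sq_eq_sq₀ (norm_nonneg _) (Finset.prod_nonneg fun i _ => T.singularValues_nonneg i),
    he.norm_sq_exteriorPowerMap,
    Finset.sum_eq_single s (fun t _ ht => by simp [ht]) (by simp), ← Fin.prod_univ_eq_prod_range]
  simp [s]

/-- **Horn's inequality**. -/
theorem prod_singularValues_comp_le (S : W →ₗ[ℝ] X) (T : V →ₗ[ℝ] W) (m : ℕ) :
    ∏ i ∈ Finset.range m, (S ∘ₗ T).singularValues i ≤
      (∏ i ∈ Finset.range m, S.singularValues i) * ∏ i ∈ Finset.range m, T.singularValues i := by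
  have prod_nonneg : 0 ≤ ∏ i ∈ Finset.range m, S.singularValues i :=
    Finset.prod_nonneg fun i _ => S.singularValues_nonneg i
  obtain hm | hm := le_or_gt m (Module.finrank ℝ V)
  · obtain ⟨x, hx, h⟩ := exists_norm_exteriorPowerMap_eq (S ∘ₗ T) hm
    rw [← h, exteriorPower.map_comp, LinearMap.comp_apply]
    refine (norm_exteriorPowerMap_le m S _).trans (mul_le_mul_of_nonneg_left ?_ prod_nonneg)
    simpa [hx] using norm_exteriorPowerMap_le m T x
  · rw [Finset.prod_eq_zero (Finset.mem_range.2 hm)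
      (LinearMap.singularValues_of_finrank_le _ le_rfl)]
    exact mul_nonneg prod_nonneg (Finset.prod_nonneg fun i _ => T.singularValues_nonneg i)

end SingularValues

section SingularValueFunction

variable {d : ℕ} {s t : ℝ} (T U : E d →L[ℝ] E d)

theorem singVal_nonneg (i : ℕ) : 0 ≤ singVal T i :=
  LinearMap.singularValues_nonneg _ i

theorem singVal_antitone : Antitone (singVal T) :=
  LinearMap.singularValues_antitone _

theorem singVal_le_norm (i : ℕ) : singVal T i ≤ ‖T‖ :=
  singularValues_le_opNorm T i

theorem prod_singVal : ∏ i ∈ Finset.range d, singVal T i = |T.det| := by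
  simpa [singVal, LinearMap.normDet_eq_abs_det] using
    (LinearMap.normDet_eq_prod_singularValues (T : E d →ₗ[ℝ] E d)).symm

theorem prod_singVal_nonneg (m : ℕ) : 0 ≤ ∏ i ∈ Finset.range m, singVal T i :=
  Finset.prod_nonneg fun i _ => singVal_nonneg T i

theorem prod_singVal_mul_le (m : ℕ) :
    ∏ i ∈ Finset.range m, singVal (T * U) i ≤
      (∏ i ∈ Finset.range m, singVal T i) * ∏ i ∈ Finset.range m, singVal U i := by
  have coe_mul : ((T * U : E d →L[ℝ] E d) : E d →ₗ[ℝ] E d) =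
      (T : E d →ₗ[ℝ] E d) ∘ₗ (U : E d →ₗ[ℝ] E d) := rfl
  unfold singVal
  rw [coe_mul]
  exact prod_singularValues_comp_le (T : E d →ₗ[ℝ] E d) (U : E d →ₗ[ℝ] E d) m

variable {T} in
theorem singVal_pos (hT : T.det ≠ 0) {i : ℕ} (hi : i < d) : 0 < singVal T i := by
  refine (singVal_nonneg T i).lt_of_ne' fun h => hT ?_
  rw [← abs_eq_zero, ← prod_singVal, Finset.prod_eq_zero (Finset.mem_range.2 hi) h]

variable {T} in
theorem abs_det_le_singVal (hT : ‖T‖ ≤ 1) {i : ℕ} (hi : i < d) : |T.det| ≤ singVal T i := by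
  rw [← prod_singVal, ← Finset.mul_prod_erase _ _ (Finset.mem_range.2 hi)]
  exact mul_le_of_le_one_right (singVal_nonneg T i) (Finset.prod_le_one
    (fun j _ => singVal_nonneg T j) fun j _ => (singVal_le_norm T j).trans hT)

/-- The exponent of the singular value `α_{i+1}` in `φ^s`, so that
`φ^s(T) = ∏ i < d, α_{i+1} ^ svfExp d s i`; in the range `s ≤ d` it fills up one singular value
after the other. -/
noncomputable def svfExp (d : ℕ) (s : ℝ) (i : ℕ) : ℝ :=
  if s ≤ d then max 0 (min 1 (s - i)) else s / d

theorem svfExp_of_le {i : ℕ} (hs : s ≤ d) (hi : s ≤ i) : svfExp d s i = 0 := by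
  rw [svfExp, if_pos hs, max_eq_left ((min_le_right _ _).trans (sub_nonpos.2 hi))]

theorem svfExp_of_add_one_le {i : ℕ} (hs : s ≤ d) (hi : i + 1 ≤ s) : svfExp d s i = 1 := by
  rw [svfExp, if_pos hs, min_eq_left (by linarith), max_eq_right zero_le_one]

theorem svfExp_of_mem_Icc {i : ℕ} (hs : s ≤ d) (hi : s ∈ Icc (i : ℝ) (i + 1)) :
    svfExp d s i = s - i := by
  rw [svfExp, if_pos hs, min_eq_right (by linarith [hi.2]), max_eq_right (by linarith [hi.1])]

theorem svfExp_nonneg (d : ℕ) (s : ℝ) (i : ℕ) : 0 ≤ svfExp d s i := by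
  unfold svfExp
  split_ifs with h
  · exact le_max_left _ _
  · have : (0 : ℝ) ≤ s := d.cast_nonneg.trans (not_le.1 h).le
    positivity

theorem svfExp_le_one (hs : s ≤ d) (i : ℕ) : svfExp d s i ≤ 1 := by
  rw [svfExp, if_pos hs]
  exact max_le zero_le_one (min_le_left _ _)

theorem svfExp_mono [NeZero d] (hst : s ≤ t) (i : ℕ) : svfExp d s i ≤ svfExp d t i := by
  have hd : (0 : ℝ) < d := mod_cast NeZero.pos d
  obtain ht | ht := le_or_gt t d
  · rw [svfExp, svfExp, if_pos (hst.trans ht), if_pos ht]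
    gcongr
  obtain hs | hs := le_or_gt s d
  · have one_le : 1 ≤ svfExp d t i := by
      rw [svfExp, if_neg ht.not_ge, le_div_iff₀ hd]
      linarith
    exact (svfExp_le_one hs i).trans one_le
  · rw [svfExp, svfExp, if_neg hs.not_ge, if_neg ht.not_ge]
    gcongr

theorem sum_max_zero_min_one_sub (hs : 0 ≤ s) (n : ℕ) :
    ∑ i ∈ Finset.range n, max 0 (min 1 (s - i)) = min s n := by
  induction n with
  | zero => simpa using hs
  | succ n ih =>
    rw [Finset.sum_range_succ, ih]
    push_cast
    grind

theorem sum_svfExp [NeZero d] (hs : 0 ≤ s) : ∑ i ∈ Finset.range d, svfExp d s i = s := by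
  have hd : (d : ℝ) ≠ 0 := NeZero.ne _
  unfold svfExp
  split_ifs with h
  · rw [sum_max_zero_min_one_sub hs, min_eq_left h]
  · rw [Finset.sum_const, Finset.card_range, nsmul_eq_mul]
    field_simp

theorem exists_nat_mem_Ioc (hs : 0 < s) (hsd : s ≤ d) :
    ∃ k : ℕ, k + 1 ≤ d ∧ s ∈ Ioc (k : ℝ) (k + 1) := by
  obtain ⟨k, hk⟩ := Nat.exists_eq_add_one_of_ne_zero (Nat.ceil_pos.2 hs).ne'
  have hsk : s ≤ (k + 1 : ℕ) := (Nat.le_ceil s).trans_eq (by rw [hk])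
  have hkd : ⌈s⌉₊ ≤ d := Nat.ceil_le.2 hsd
  exact ⟨k, by lia, Nat.lt_ceil.1 (by lia), mod_cast hsk⟩

theorem svf_of_mem_Ioc {k : ℕ} (hs : s ∈ Ioc (k : ℝ) (k + 1)) (hkd : k + 1 ≤ d) :
    svf s T = (∏ i ∈ Finset.range k, singVal T i) * singVal T k ^ (s - k) := by
  have ceil_eq : ⌈s⌉₊ = k + 1 := (Nat.ceil_eq_iff k.succ_ne_zero).2 (by simpa using hs)
  have hs0 : 0 < s := k.cast_nonneg.trans_lt hs.1
  have hsd : s ≤ d := hs.2.trans (mod_cast hkd)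
  rw [svf, if_neg hs0.not_ge, if_pos hsd, ceil_eq, Nat.add_sub_cancel]
  congr 2
  push_cast
  ring

theorem svf_eq_prod (s : ℝ) : svf s T = ∏ i ∈ Finset.range d, singVal T i ^ svfExp d s i := by
  obtain hs | hs := le_or_gt s 0
  · rw [svf, if_pos hs, Finset.prod_eq_one fun i _ => ?_]
    rw [svfExp_of_le (hs.trans d.cast_nonneg) (hs.trans i.cast_nonneg), Real.rpow_zero]
  obtain hsd | hsd := le_or_gt s d
  · obtain ⟨k, hkd, hks, hsk⟩ := exists_nat_mem_Ioc hs hsd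
    rw [svf_of_mem_Ioc T ⟨hks, hsk⟩ hkd, ← Finset.prod_subset (Finset.range_mono hkd),
      Finset.prod_range_succ, svfExp_of_mem_Icc hsd ⟨hks.le, hsk⟩]
    · congr 1
      refine Finset.prod_congr rfl fun i hi => ?_
      have : (i : ℝ) + 1 ≤ k := mod_cast Finset.mem_range.1 hi
      rw [svfExp_of_add_one_le hsd (this.trans hks.le), Real.rpow_one]
    · intro i _ hi
      have : (k : ℝ) + 1 ≤ i := mod_cast not_lt.1 fun h => hi (Finset.mem_range.2 h)
      rw [svfExp_of_le hsd (hsk.trans this), Real.rpow_zero]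
  · simp only [svf, svfExp, if_neg hs.not_ge, if_neg hsd.not_ge]
    exact (Real.finsetProd_rpow _ _ (fun i _ => singVal_nonneg T i) _).symm

theorem svf_zero : svf 0 T = 1 := by simp [svf]

theorem svf_nonneg (s : ℝ) : 0 ≤ svf s T := by
  rw [svf_eq_prod]
  exact Finset.prod_nonneg fun i _ => Real.rpow_nonneg (singVal_nonneg T i) _

variable {T} in
theorem svf_pos (hT : T.det ≠ 0) (s : ℝ) : 0 < svf s T := by
  rw [svf_eq_prod]
  exact Finset.prod_pos fun i hi => Real.rpow_pos_of_pos (singVal_pos hT (Finset.mem_range.1 hi)) _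

theorem svf_eq_prod_rpow_mul_prod_rpow {k : ℕ} (hs : s ∈ Ioc (k : ℝ) (k + 1)) (hkd : k + 1 ≤ d) :
    svf s T = (∏ i ∈ Finset.range k, singVal T i) ^ (k + 1 - s) *
      (∏ i ∈ Finset.range (k + 1), singVal T i) ^ (s - k) := by
  have hP := prod_singVal_nonneg T k
  rw [svf_of_mem_Ioc T hs hkd, Finset.prod_range_succ, Real.mul_rpow hP (singVal_nonneg T k),
    ← mul_assoc, ← Real.rpow_add_of_nonneg hP (by linarith [hs.2]) (by linarith [hs.1])]
  simp

theorem svf_mul_le (s : ℝ) : svf s (T * U) ≤ svf s T * svf s U := by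
  obtain hs | hs := le_or_gt s 0
  · simp [svf, hs]
  have prod_rpow_le (m : ℕ) {p : ℝ} (hp : 0 ≤ p) :
      (∏ i ∈ Finset.range m, singVal (T * U) i) ^ p ≤
        (∏ i ∈ Finset.range m, singVal T i) ^ p * (∏ i ∈ Finset.range m, singVal U i) ^ p := by
    rw [← Real.mul_rpow (prod_singVal_nonneg T m) (prod_singVal_nonneg U m)]
    exact Real.rpow_le_rpow (prod_singVal_nonneg _ m) (prod_singVal_mul_le T U m) hp
  obtain hsd | hsd := le_or_gt s d
  · obtain ⟨k, hkd, hks, hsk⟩ := exists_nat_mem_Ioc hs hsd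
    simp only [svf_eq_prod_rpow_mul_prod_rpow _ ⟨hks, hsk⟩ hkd]
    rw [mul_mul_mul_comm]
    exact mul_le_mul (prod_rpow_le k (by linarith)) (prod_rpow_le (k + 1) (by linarith))
      (Real.rpow_nonneg (prod_singVal_nonneg _ _) _)
      (mul_nonneg (Real.rpow_nonneg (prod_singVal_nonneg _ _) _)
        (Real.rpow_nonneg (prod_singVal_nonneg _ _) _))
  · simp only [svf, if_neg hs.not_ge, if_neg hsd.not_ge]
    exact prod_rpow_le d (by positivity)

theorem svf_eq_svf_mul_prod [NeZero d] (hst : s ≤ t) : svf t T = svf s T *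
    ∏ i ∈ Finset.range d, singVal T i ^ (svfExp d t i - svfExp d s i) := by
  rw [svf_eq_prod, svf_eq_prod, ← Finset.prod_mul_distrib]
  refine Finset.prod_congr rfl fun i _ => ?_
  rw [← Real.rpow_add_of_nonneg (singVal_nonneg T i) (svfExp_nonneg d s i)
    (sub_nonneg.2 (svfExp_mono hst i)), add_sub_cancel]

theorem rpow_sub_eq_prod_svfExp [NeZero d] {K : ℝ} (hK : 0 ≤ K) (hs : 0 ≤ s) (hst : s ≤ t) :
    K ^ (t - s) = ∏ i ∈ Finset.range d, K ^ (svfExp d t i - svfExp d s i) := by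
  rw [← Real.rpow_sum_of_nonneg hK fun i _ => sub_nonneg.2 (svfExp_mono hst i),
    Finset.sum_sub_distrib, sum_svfExp hs, sum_svfExp (hs.trans hst)]

theorem svf_le_svf_mul_norm_rpow [NeZero d] (hs : 0 ≤ s) (hst : s ≤ t) :
    svf t T ≤ svf s T * ‖T‖ ^ (t - s) := by
  rw [svf_eq_svf_mul_prod T hst, rpow_sub_eq_prod_svfExp (d := d) (norm_nonneg T) hs hst]
  refine mul_le_mul_of_nonneg_left (Finset.prod_le_prod
    (fun i _ => Real.rpow_nonneg (singVal_nonneg T i) _) fun i _ => ?_) (svf_nonneg T s)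
  exact Real.rpow_le_rpow (singVal_nonneg T i) (singVal_le_norm T i)
    (sub_nonneg.2 (svfExp_mono hst i))

variable {T} in
theorem svf_mul_abs_det_rpow_le [NeZero d] (hT : ‖T‖ ≤ 1) (hs : 0 ≤ s) (hst : s ≤ t) :
    svf s T * |T.det| ^ (t - s) ≤ svf t T := by
  rw [svf_eq_svf_mul_prod T hst, rpow_sub_eq_prod_svfExp (d := d) (abs_nonneg _) hs hst]
  refine mul_le_mul_of_nonneg_left (Finset.prod_le_prod
    (fun i _ => Real.rpow_nonneg (abs_nonneg _) _) fun i hi => ?_) (svf_nonneg T s)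
  exact Real.rpow_le_rpow (abs_nonneg _) (abs_det_le_singVal hT (Finset.mem_range.1 hi))
    (sub_nonneg.2 (svfExp_mono hst i))

theorem min_one_le_rpow {x e : ℝ} (hx : 0 ≤ x) (he0 : 0 ≤ e) (he1 : e ≤ 1) :
    min 1 x ≤ x ^ e := by
  obtain h | h := le_total 1 x
  · exact (min_le_left _ _).trans (Real.one_le_rpow h he0)
  · calc min 1 x ≤ x ^ (1 : ℝ) := by simp
      _ ≤ x ^ e := Real.rpow_le_rpow_of_exponent_ge' hx h he0 he1

theorem prod_min_one_div_singVal_le [NeZero d] {r : ℝ} (hs : 0 ≤ s) (hsd : s ≤ d) (hr : 0 ≤ r) :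
    ∏ i ∈ Finset.range d, min 1 (r / singVal T i) ≤ r ^ s / svf s T := by
  calc ∏ i ∈ Finset.range d, min 1 (r / singVal T i)
      ≤ ∏ i ∈ Finset.range d, r ^ svfExp d s i / singVal T i ^ svfExp d s i := by
        gcongr with i _
        · exact fun i _ => le_min zero_le_one (div_nonneg hr (singVal_nonneg T i))
        · rw [← Real.div_rpow hr (singVal_nonneg T i)]
          exact min_one_le_rpow (div_nonneg hr (singVal_nonneg T i)) (svfExp_nonneg d s i)
            (svfExp_le_one hsd i)
    _ = r ^ s / svf s T := by
        rw [Finset.prod_div_distrib, ← svf_eq_prod,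
          ← Real.rpow_sum_of_nonneg hr fun i _ => svfExp_nonneg d s i, sum_svfExp hs]

end SingularValueFunction

section Words

variable {d M : ℕ} (T : Fin M → (E d →L[ℝ] E d))

@[simp] theorem wordMap_nil : wordMap T [] = 1 := rfl

@[simp] theorem wordMap_cons (i : Fin M) (u : List (Fin M)) :
    wordMap T (i :: u) = T i * wordMap T u := by simp [wordMap]

@[simp] theorem wordMap_append (u v : List (Fin M)) :
    wordMap T (u ++ v) = wordMap T u * wordMap T v := by simp [wordMap]

theorem det_wordMap (u : List (Fin M)) :
    (wordMap T u).det = (u.map fun j => (T j).det).prod := by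
  induction u with
  | nil => simp [ContinuousLinearMap.det]
  | cons i u ih =>
    rw [wordMap_cons, List.map_cons, List.prod_cons, ← ih]
    exact LinearMap.det_comp _ _

variable {T} in
theorem det_wordMap_ne_zero (hdet : ∀ j, (T j).det ≠ 0) (u : List (Fin M)) :
    (wordMap T u).det ≠ 0 := by
  simpa [det_wordMap, List.prod_eq_zero_iff] using fun j _ => hdet j

theorem norm_wordMap_le (u : List (Fin M)) : ‖wordMap T u‖ ≤ ‖T‖ ^ u.length := by
  induction u with
  | nil => exact ContinuousLinearMap.norm_id_le
  | cons i u ih =>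
    rw [wordMap_cons, List.length_cons, pow_succ']
    exact (norm_mul_le _ _).trans (mul_le_mul (norm_le_pi_norm T i) ih (norm_nonneg _)
      (norm_nonneg _))

variable {T} in
theorem norm_wordMap_le_one (hT : ‖T‖ ≤ 1) (u : List (Fin M)) : ‖wordMap T u‖ ≤ 1 :=
  (norm_wordMap_le T u).trans (pow_le_one₀ (norm_nonneg _) hT)

variable {T} in
theorem pow_le_abs_det_wordMap {δ : ℝ} (hδ : 0 ≤ δ) (h : ∀ j, δ ≤ |(T j).det|)
    (u : List (Fin M)) : δ ^ u.length ≤ |(wordMap T u).det| := by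
  rw [det_wordMap]
  induction u with
  | nil => simp
  | cons i u ih =>
    rw [List.map_cons, List.prod_cons, abs_mul, List.length_cons, pow_succ']
    gcongr
    exact h i

end Words

section LevelSums

variable {d M : ℕ} {T : Fin M → (E d →L[ℝ] E d)} {s t δ : ℝ}

theorem exists_pos_le_abs_det [Nonempty (Fin M)] (hdet : ∀ j, (T j).det ≠ 0) :
    ∃ δ : ℝ, 0 < δ ∧ ∀ j, δ ≤ |(T j).det| := by
  obtain ⟨j, hj⟩ := Finite.exists_min fun j => |(T j).det|
  exact ⟨_, abs_pos.2 (hdet j), hj⟩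

variable (T) in
theorem svf_wordMap_le [NeZero d] (hs : 0 ≤ s) (hst : s ≤ t) (u : List (Fin M)) :
    svf t (wordMap T u) ≤ svf s (wordMap T u) * (‖T‖ ^ (t - s)) ^ u.length := by
  refine (svf_le_svf_mul_norm_rpow _ hs hst).trans
    (mul_le_mul_of_nonneg_left ?_ (svf_nonneg _ s))
  rw [Real.rpow_pow_comm (norm_nonneg T)]
  exact Real.rpow_le_rpow (norm_nonneg _) (norm_wordMap_le T u) (sub_nonneg.2 hst)

theorem le_svf_wordMap [NeZero d] (hT : ‖T‖ ≤ 1) (hδ : 0 ≤ δ) (hδT : ∀ j, δ ≤ |(T j).det|)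
    (hs : 0 ≤ s) (hst : s ≤ t) (u : List (Fin M)) :
    svf s (wordMap T u) * (δ ^ (t - s)) ^ u.length ≤ svf t (wordMap T u) := by
  refine le_trans (mul_le_mul_of_nonneg_left ?_ (svf_nonneg _ s))
    (svf_mul_abs_det_rpow_le (norm_wordMap_le_one hT u) hs hst)
  rw [Real.rpow_pow_comm hδ]
  exact Real.rpow_le_rpow (pow_nonneg hδ _) (pow_le_abs_det_wordMap hδ hδT u) (sub_nonneg.2 hst)

variable (T) in
theorem svf_wordMap_le_pow [NeZero d] (hs : 0 ≤ s) (u : List (Fin M)) :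
    svf s (wordMap T u) ≤ (‖T‖ ^ s) ^ u.length := by
  simpa [svf_zero] using svf_wordMap_le T le_rfl hs u

variable (T s) in
/-- The `k`-th level sum `∑_{|u| = k} φ^s(T_u)`. -/
noncomputable def levelSum (k : ℕ) : ℝ :=
  ∑ u : Fin k → Fin M, svf s (wordMap T (List.ofFn u))

variable (T s) in
theorem levelSum_nonneg (k : ℕ) : 0 ≤ levelSum T s k :=
  Finset.sum_nonneg fun _ _ => svf_nonneg _ s

theorem levelSum_pos [Nonempty (Fin M)] (hdet : ∀ j, (T j).det ≠ 0) (s : ℝ) (k : ℕ) :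
    0 < levelSum T s k :=
  Finset.sum_pos (fun _ _ => svf_pos (det_wordMap_ne_zero hdet _) s) Finset.univ_nonempty

variable (T) in
theorem levelSum_zero (k : ℕ) : levelSum T 0 k = (M : ℝ) ^ k := by
  simp [levelSum, svf_zero]

theorem sum_ofFn_add {α R : Type*} [Fintype α] [AddCommMonoid R] (f : List α → R) (j k : ℕ) :
    ∑ u : Fin (j + k) → α, f (List.ofFn u) =
      ∑ v : Fin j → α, ∑ w : Fin k → α, f (List.ofFn v ++ List.ofFn w) := by
  rw [← Fintype.sum_prod_type', ← (Fin.appendEquiv j k).sum_comp]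
  refine Finset.sum_congr rfl fun p _ => ?_
  rw [← List.ofFn_fin_append]
  rfl

variable (T s) in
theorem levelSum_add_le (j k : ℕ) : levelSum T s (j + k) ≤ levelSum T s j * levelSum T s k := by
  rw [levelSum, sum_ofFn_add (fun u => svf s (wordMap T u)), levelSum, levelSum,
    Finset.sum_mul_sum]
  refine Finset.sum_le_sum fun v _ => Finset.sum_le_sum fun w _ => ?_
  rw [wordMap_append]
  exact svf_mul_le _ _ s

variable (T) in
theorem levelSum_le_mul [NeZero d] (hs : 0 ≤ s) (hst : s ≤ t) (k : ℕ) :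
    levelSum T t k ≤ levelSum T s k * (‖T‖ ^ (t - s)) ^ k := by
  rw [levelSum, levelSum, Finset.sum_mul]
  exact Finset.sum_le_sum fun u _ => by simpa using svf_wordMap_le T hs hst (List.ofFn u)

theorem mul_le_levelSum [NeZero d] (hT : ‖T‖ ≤ 1) (hδ : 0 ≤ δ) (hδT : ∀ j, δ ≤ |(T j).det|)
    (hs : 0 ≤ s) (hst : s ≤ t) (k : ℕ) :
    levelSum T s k * (δ ^ (t - s)) ^ k ≤ levelSum T t k := by
  rw [levelSum, levelSum, Finset.sum_mul]
  exact Finset.sum_le_sum fun u _ => by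
    simpa using le_svf_wordMap hT hδ hδT hs hst (List.ofFn u)

variable (T s) in
/-- The growth rate `lim_k (∑_{|u| = k} φ^s(T_u))^{1/k}` of the level sums; the affinity dimension
is the exponent `s` at which it equals `1`. -/
noncomputable def growthRate : ℝ :=
  limUnder atTop fun k : ℕ => levelSum T s k ^ (1 / (k : ℝ))

theorem subadditive_log_levelSum [Nonempty (Fin M)] (hdet : ∀ j, (T j).det ≠ 0) (s : ℝ) :
    Subadditive fun k => Real.log (levelSum T s k) := fun j k => by
  rw [← Real.log_mul (levelSum_pos hdet s j).ne' (levelSum_pos hdet s k).ne']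
  exact Real.log_le_log (levelSum_pos hdet s _) (levelSum_add_le T s j k)

theorem bddBelow_log_levelSum_div [NeZero d] [Nonempty (Fin M)] (hdet : ∀ j, (T j).det ≠ 0)
    (hT : ‖T‖ ≤ 1) (hs : 0 ≤ s) :
    BddBelow (range fun k : ℕ => Real.log (levelSum T s k) / k) := by
  obtain ⟨δ, hδ, hδT⟩ := exists_pos_le_abs_det hdet
  have hM : (1 : ℝ) ≤ M := mod_cast Fin.pos_iff_nonempty.2 ‹_›
  have hδs : 0 < δ ^ s := Real.rpow_pos_of_pos hδ s
  refine ⟨min 0 (Real.log (δ ^ s)), ?_⟩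
  rintro _ ⟨k, rfl⟩
  obtain rfl | hk := k.eq_zero_or_pos
  · simp
  have pow_le : (δ ^ s) ^ k ≤ levelSum T s k :=
    calc (δ ^ s) ^ k ≤ (M : ℝ) ^ k * (δ ^ s) ^ k :=
          le_mul_of_one_le_left (pow_pos hδs k).le (one_le_pow₀ hM)
      _ ≤ levelSum T s k := by
          simpa only [levelSum_zero, sub_zero] using mul_le_levelSum hT hδ.le hδT le_rfl hs k
  refine (min_le_right _ _).trans ?_
  rw [le_div_iff₀ (mod_cast hk), mul_comm, ← Real.log_pow]
  exact Real.log_le_log (pow_pos hδs k) pow_le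

theorem tendsto_growthRate [NeZero d] [Nonempty (Fin M)] (hdet : ∀ j, (T j).det ≠ 0)
    (hT : ‖T‖ ≤ 1) (hs : 0 ≤ s) :
    Tendsto (fun k : ℕ => levelSum T s k ^ (1 / (k : ℝ))) atTop (𝓝 (growthRate T s)) := by
  have hsub := subadditive_log_levelSum hdet s
  refine tendsto_nhds_limUnder ⟨Real.exp hsub.lim, ((Real.continuous_exp.tendsto _).comp
    (hsub.tendsto_lim (bddBelow_log_levelSum_div hdet hT hs))).congr fun k => ?_⟩
  rw [Function.comp_apply, Real.rpow_def_of_pos (levelSum_pos hdet s k), mul_one_div]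

theorem growthRate_nonneg [NeZero d] [Nonempty (Fin M)] (hdet : ∀ j, (T j).det ≠ 0)
    (hT : ‖T‖ ≤ 1) (hs : 0 ≤ s) : 0 ≤ growthRate T s :=
  ge_of_tendsto' (tendsto_growthRate hdet hT hs) fun k =>
    Real.rpow_nonneg (levelSum_nonneg T s k) _

theorem mul_pow_rpow_one_div {x y : ℝ} (hx : 0 ≤ x) (hy : 0 ≤ y) {k : ℕ} (hk : k ≠ 0) :
    (x * y ^ k) ^ (1 / (k : ℝ)) = x ^ (1 / (k : ℝ)) * y := by
  rw [Real.mul_rpow hx (pow_nonneg hy k), one_div, Real.pow_rpow_inv_natCast hy hk]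

theorem growthRate_le_mul [NeZero d] [Nonempty (Fin M)] (hdet : ∀ j, (T j).det ≠ 0)
    (hT : ‖T‖ ≤ 1) (hs : 0 ≤ s) (hst : s ≤ t) :
    growthRate T t ≤ growthRate T s * ‖T‖ ^ (t - s) := by
  refine le_of_tendsto_of_tendsto (tendsto_growthRate hdet hT (hs.trans hst))
    ((tendsto_growthRate hdet hT hs).mul_const _) ?_
  filter_upwards [eventually_ne_atTop 0] with k hk
  rw [← mul_pow_rpow_one_div (levelSum_nonneg T s k) (by positivity) hk]
  exact Real.rpow_le_rpow (levelSum_nonneg T t k) (levelSum_le_mul T hs hst k) (by positivity)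

theorem mul_le_growthRate [NeZero d] [Nonempty (Fin M)] (hdet : ∀ j, (T j).det ≠ 0)
    (hT : ‖T‖ ≤ 1) (hδ : 0 ≤ δ) (hδT : ∀ j, δ ≤ |(T j).det|) (hs : 0 ≤ s) (hst : s ≤ t) :
    growthRate T s * δ ^ (t - s) ≤ growthRate T t := by
  refine le_of_tendsto_of_tendsto ((tendsto_growthRate hdet hT hs).mul_const _)
    (tendsto_growthRate hdet hT (hs.trans hst)) ?_
  filter_upwards [eventually_ne_atTop 0] with k hk
  have rpow_nonneg : 0 ≤ δ ^ (t - s) := Real.rpow_nonneg hδ _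
  rw [← mul_pow_rpow_one_div (levelSum_nonneg T s k) rpow_nonneg hk]
  exact Real.rpow_le_rpow (mul_nonneg (levelSum_nonneg T s k) (pow_nonneg rpow_nonneg k))
    (mul_le_levelSum hT hδ hδT hs hst k) (by positivity)

theorem growthRate_zero [NeZero d] [Nonempty (Fin M)] (hdet : ∀ j, (T j).det ≠ 0)
    (hT : ‖T‖ ≤ 1) : growthRate T 0 = M := by
  refine tendsto_nhds_unique (tendsto_growthRate hdet hT le_rfl)
    (tendsto_const_nhds.congr' ?_)
  filter_upwards [eventually_ne_atTop 0] with k hk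
  rw [levelSum_zero, one_div, Real.pow_rpow_inv_natCast M.cast_nonneg hk]

theorem growthRate_pos [NeZero d] [Nonempty (Fin M)] (hdet : ∀ j, (T j).det ≠ 0)
    (hT : ‖T‖ ≤ 1) (hs : 0 ≤ s) : 0 < growthRate T s := by
  obtain ⟨δ, hδ, hδT⟩ := exists_pos_le_abs_det hdet
  have hM : 0 < growthRate T 0 := by
    rw [growthRate_zero hdet hT]
    exact mod_cast Fin.pos_iff_nonempty.2 ‹_›
  exact (mul_pos hM (Real.rpow_pos_of_pos hδ _)).trans_le
    (mul_le_growthRate hdet hT hδ.le hδT le_rfl hs)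

theorem strictAntiOn_growthRate [NeZero d] [Nonempty (Fin M)] (hdet : ∀ j, (T j).det ≠ 0)
    (hT : ‖T‖ < 1) : StrictAntiOn (growthRate T) (Ici 0) := fun _ hs _ _ hst =>
  (growthRate_le_mul hdet hT.le hs hst.le).trans_lt <|
    mul_lt_of_lt_one_right (growthRate_pos hdet hT.le hs) <|
      Real.rpow_lt_one (norm_nonneg T) hT (sub_pos.2 hst)

theorem continuousOn_growthRate [NeZero d] [Nonempty (Fin M)] (hdet : ∀ j, (T j).det ≠ 0)
    (hT : ‖T‖ < 1) : ContinuousOn (growthRate T) (Ici 0) := by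
  intro s hs
  obtain ⟨δ, hδ, hδT⟩ := exists_pos_le_abs_det hdet
  have tendsto_mul : Tendsto (fun t => growthRate T s * δ ^ (t - s)) (𝓝[Ici 0] s)
      (𝓝 (growthRate T s)) := by
    have rpow_continuousAt : ContinuousAt (fun t : ℝ => growthRate T s * δ ^ (t - s)) s :=
      continuousAt_const.mul (continuousAt_const.rpow (by fun_prop) (Or.inl hδ.ne'))
    simpa [ContinuousAt] using rpow_continuousAt.mono_left nhdsWithin_le_nhds
  have tendsto_min := (tendsto_const_nhds (x := growthRate T s)).min tendsto_mul
  have tendsto_max := (tendsto_const_nhds (x := growthRate T s)).max tendsto_mul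
  rw [min_self] at tendsto_min
  rw [max_self] at tendsto_max
  refine tendsto_of_tendsto_of_tendsto_of_le_of_le' tendsto_min tendsto_max ?_ ?_
  · filter_upwards [self_mem_nhdsWithin] with t ht
    obtain hst | hts := le_total s t
    · exact (min_le_right _ _).trans (mul_le_growthRate hdet hT.le hδ.le hδT hs hst)
    · exact (min_le_left _ _).trans ((strictAntiOn_growthRate hdet hT).antitoneOn ht hs hts)
  · filter_upwards [self_mem_nhdsWithin] with t ht
    obtain hst | hts := le_total s t
    · exact ((strictAntiOn_growthRate hdet hT).antitoneOn hs ht hst).trans (le_max_left _ _)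
    · refine le_trans ?_ (le_max_right _ _)
      rw [← neg_sub, Real.rpow_neg hδ.le, ← div_eq_mul_inv,
        le_div_iff₀ (Real.rpow_pos_of_pos hδ _)]
      exact mul_le_growthRate hdet hT.le hδ.le hδT ht hts

theorem exists_growthRate_eq_one [NeZero d] [Nonempty (Fin M)] (hdet : ∀ j, (T j).det ≠ 0)
    (hT : ‖T‖ < 1) : ∃ s : ℝ, 0 ≤ s ∧ growthRate T s = 1 := by
  have hM : (1 : ℝ) ≤ M := mod_cast Fin.pos_iff_nonempty.2 ‹_›
  obtain ⟨k, hk⟩ := exists_pow_lt_of_lt_one (x := 1 / (M : ℝ)) (by positivity) hT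
  have growthRate_le_one : growthRate T k ≤ 1 :=
    calc growthRate T k ≤ M * ‖T‖ ^ k := by
          simpa only [growthRate_zero hdet hT.le, sub_zero, Real.rpow_natCast] using
            growthRate_le_mul hdet hT.le le_rfl k.cast_nonneg
      _ ≤ M * (1 / M) := by gcongr
      _ = 1 := mul_one_div_cancel (by positivity)
  have one_le_growthRate : 1 ≤ growthRate T 0 := by rwa [growthRate_zero hdet hT.le]
  obtain ⟨s, hs, h⟩ := intermediate_value_Icc' k.cast_nonneg
    ((continuousOn_growthRate hdet hT).mono Icc_subset_Ici_self)
    ⟨growthRate_le_one, one_le_growthRate⟩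
  exact ⟨s, hs.1, h⟩

theorem tendsto_levelSum_zero [NeZero d] [Nonempty (Fin M)] (hdet : ∀ j, (T j).det ≠ 0)
    (hT : ‖T‖ ≤ 1) (hs : 0 ≤ s) (h : growthRate T s < 1) :
    Tendsto (levelSum T s) atTop (𝓝 0) := by
  obtain ⟨q, hq, hq1⟩ := exists_between h
  have hq0 : 0 ≤ q := (growthRate_nonneg hdet hT hs).trans hq.le
  refine squeeze_zero' (Eventually.of_forall fun k => levelSum_nonneg T s k) ?_
    (tendsto_pow_atTop_nhds_zero_of_lt_one hq0 hq1)
  filter_upwards [(tendsto_growthRate hdet hT hs).eventually_lt_const hq,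
    eventually_ne_atTop 0] with k hk hk0
  rw [← Real.rpow_inv_natCast_pow (levelSum_nonneg T s k) hk0, ← one_div]
  exact pow_le_pow_left₀ (Real.rpow_nonneg (levelSum_nonneg T s k) _) hk.le k

end LevelSums

section Cylinders

variable {M : ℕ}

/-- The word formed by the first `k` letters of `v`. -/
def initWord (v : ℕ → Fin M) (k : ℕ) : List (Fin M) := List.ofFn fun i : Fin k => v i

@[simp] theorem length_initWord (v : ℕ → Fin M) (k : ℕ) : (initWord v k).length = k := by
  simp [initWord]

@[simp] theorem initWord_zero (v : ℕ → Fin M) : initWord v 0 = [] := by simp [initWord]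

theorem initWord_succ (v : ℕ → Fin M) (k : ℕ) :
    initWord v (k + 1) = v 0 :: initWord (fun n => v (n + 1)) k := by
  simp [initWord, List.ofFn_succ]

/-- The infinite word `i v_0 v_1 ⋯`. -/
def consWord (i : Fin M) (v : ℕ → Fin M) : ℕ → Fin M
  | 0 => i
  | n + 1 => v n

theorem initWord_prefix (v : ℕ → Fin M) {k n : ℕ} (hkn : k ≤ n) :
    initWord v k <+: initWord v n := by
  rw [List.prefix_iff_eq_take]
  refine List.ext_getElem (by simpa using hkn) fun i _ _ => ?_
  simp [initWord]

theorem initWord_length_eq_iff {v : ℕ → Fin M} {u : List (Fin M)} :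
    initWord v u.length = u ↔ v ∈ cylinder u := by
  simp only [List.ext_getElem_iff, initWord, List.getElem_ofFn, List.length_ofFn, true_and]
  exact ⟨fun h i hi => h i hi hi, fun h i _ hi => h i hi⟩

theorem mem_cylinder_initWord_iff {v w : ℕ → Fin M} {k : ℕ} :
    w ∈ cylinder (initWord v k) ↔ ∀ i < k, w i = v i := by
  simp [cylinder, initWord]

theorem mem_cylinder_initWord (v : ℕ → Fin M) (k : ℕ) : v ∈ cylinder (initWord v k) :=
  mem_cylinder_initWord_iff.2 fun _ _ => rfl

theorem exists_initWord_eq_ofFn [Nonempty (Fin M)] {n : ℕ} (w : Fin n → Fin M) :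
    ∃ v, initWord v n = List.ofFn w := by
  obtain ⟨i⟩ := ‹Nonempty (Fin M)›
  exact ⟨fun k => if h : k < n then w ⟨k, h⟩ else i, by simp [initWord]⟩

theorem cylinder_nonempty [Nonempty (Fin M)] (u : List (Fin M)) : (cylinder u).Nonempty :=
  ⟨fun i => u.getD i (Classical.arbitrary _), fun i hi => by simp [hi]⟩

@[simp] theorem cylinder_nil : cylinder ([] : List (Fin M)) = univ := by
  ext; simp [cylinder]

theorem consWord_mem_cylinder_cons_iff {i j : Fin M} {v : ℕ → Fin M} {u : List (Fin M)} :
    consWord i v ∈ cylinder (j :: u) ↔ i = j ∧ v ∈ cylinder u := by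
  refine ⟨fun h => ⟨h 0 (by simp), fun n hn => h (n + 1) (by simpa using hn)⟩, ?_⟩
  rintro ⟨rfl, h⟩ (_ | n) hn
  · rfl
  · exact h n (by simpa using hn)

theorem measurable_consWord (i : Fin M) : Measurable (consWord i) :=
  measurable_pi_lambda _ fun n => by
    cases n with
    | zero => exact measurable_const
    | succ n => exact measurable_pi_apply n

theorem cylinder_subset_iUnion_append (u : List (Fin M)) :
    cylinder u ⊆ ⋃ i, cylinder (u ++ [i]) := by
  intro w hw
  refine mem_iUnion.2 ⟨w u.length, fun i hi => ?_⟩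
  rw [List.length_append, List.length_singleton] at hi
  obtain h | rfl := (Nat.lt_succ_iff.1 hi).lt_or_eq
  · rw [hw i h, List.getElem_append_left h]
  · simp

theorem isClopen_cylinder (u : List (Fin M)) : IsClopen (cylinder u) := by
  have eq_iInter : cylinder u = ⋂ i : Fin u.length, (fun v : ℕ → Fin M => v i) ⁻¹' {u[i]} := by
    ext v
    simp [cylinder, Fin.forall_iff]
  rw [eq_iInter]
  exact isClopen_iInter_of_finite fun i =>
    (isClopen_discrete _).preimage (continuous_apply _)

theorem measurableSet_cylinder (u : List (Fin M)) : MeasurableSet (cylinder u) :=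
  (isClopen_cylinder u).isOpen.measurableSet

end Cylinders

section NetMeasure

variable {d M : ℕ} {T : Fin M → (E d →L[ℝ] E d)} {s t : ℝ} {k n : ℕ} {G : Set (ℕ → Fin M)}

theorem netPremeasure_le_tsum {A : Set (List (Fin M))} (hA : ∀ u ∈ A, k ≤ u.length)
    (hG : G ⊆ ⋃ u ∈ A, cylinder u) :
    netPremeasure T s k G ≤ ∑' u : A, ENNReal.ofReal (svf s (wordMap T u)) :=
  iInf₂_le A ⟨hA, hG⟩

theorem exists_tsum_lt_of_netPremeasure_lt {c : ℝ≥0∞} (h : netPremeasure T s k G < c) :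
    ∃ A : Set (List (Fin M)), (∀ u ∈ A, k ≤ u.length) ∧ G ⊆ ⋃ u ∈ A, cylinder u ∧
      ∑' u : A, ENNReal.ofReal (svf s (wordMap T u)) < c := by
  simp only [netPremeasure, iInf_lt_iff] at h
  obtain ⟨A, ⟨hA, hG⟩, hlt⟩ := h
  exact ⟨A, hA, hG, hlt⟩

variable (T s G) in
theorem monotone_netPremeasure : Monotone fun k => netPremeasure T s k G :=
  fun _ _ hjk => le_iInf₂ fun A hA => iInf₂_le A ⟨fun u hu => hjk.trans (hA.1 u hu), hA.2⟩

variable (T s k G) in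
theorem netPremeasure_le_netMeasure : netPremeasure T s k G ≤ netMeasure T s G :=
  le_iSup (fun k => netPremeasure T s k G) k

variable (T s G) in
theorem netPremeasure_le_levelSum (hkn : k ≤ n) :
    netPremeasure T s k G ≤ ENNReal.ofReal (levelSum T s n) := by
  refine (netPremeasure_le_tsum (A := range (List.ofFn : (Fin n → Fin M) → List (Fin M)))
    (forall_mem_range.2 fun _ => by simpa using hkn) fun v _ =>
      mem_iUnion₂.2 ⟨_, mem_range_self _, mem_cylinder_initWord v n⟩).trans_eq ?_
  rw [tsum_range (fun u => ENNReal.ofReal (svf s (wordMap T u))) List.ofFn_injective,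
    tsum_fintype, levelSum, ENNReal.ofReal_sum_of_nonneg fun _ _ => svf_nonneg _ s]

theorem netMeasure_eq_zero_of_growthRate_lt_one [NeZero d] [Nonempty (Fin M)]
    (hdet : ∀ j, (T j).det ≠ 0) (hT : ‖T‖ ≤ 1) (hs : 0 ≤ s) (h : growthRate T s < 1) :
    netMeasure T s univ = 0 := by
  refine le_antisymm (iSup_le fun k => ?_) bot_le
  have tendsto_zero : Tendsto (fun n => ENNReal.ofReal (levelSum T s n)) atTop (𝓝 0) := by
    simpa using ENNReal.tendsto_ofReal (tendsto_levelSum_zero hdet hT hs h)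
  refine ge_of_tendsto tendsto_zero ?_
  filter_upwards [eventually_ge_atTop k] with n hkn
  exact netPremeasure_le_levelSum T s univ hkn

theorem exists_finset_cover_of_netPremeasure_lt {c : ℝ} (hc : 0 ≤ c)
    (h : netPremeasure T s k univ < ENNReal.ofReal c) :
    ∃ A : Finset (List (Fin M)), (∀ u ∈ A, k ≤ u.length) ∧ univ ⊆ ⋃ u ∈ A, cylinder u ∧
      ∑ u ∈ A, svf s (wordMap T u) ≤ c := by
  obtain ⟨A, hA, hcover, hlt⟩ := exists_tsum_lt_of_netPremeasure_lt h
  obtain ⟨B, hBA, hB, hBcover⟩ := isCompact_univ.elim_finite_subcover_image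
    (fun u _ => (isClopen_cylinder u).isOpen) hcover
  refine ⟨hB.toFinset, fun u hu => hA u (hBA (hB.mem_toFinset.1 hu)), by simpa using hBcover, ?_⟩
  rw [← ENNReal.ofReal_le_ofReal_iff hc,
    ENNReal.ofReal_sum_of_nonneg fun _ _ => svf_nonneg _ s]
  calc ∑ u ∈ hB.toFinset, ENNReal.ofReal (svf s (wordMap T u))
      = ∑' u : B, ENNReal.ofReal (svf s (wordMap T u)) := by
        rw [← Finset.tsum_subtype' hB.toFinset fun u => ENNReal.ofReal (svf s (wordMap T u)),
          hB.coe_toFinset]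
    _ ≤ ∑' u : A, ENNReal.ofReal (svf s (wordMap T u)) :=
        ENNReal.tsum_mono_subtype (fun u => ENNReal.ofReal (svf s (wordMap T u))) hBA
    _ ≤ ENNReal.ofReal c := hlt.le

variable (T s) in
theorem sum_svf_of_prefix_le (u : List (Fin M)) (k : ℕ) :
    ∑ w : Fin (u.length + k) → Fin M with u <+: List.ofFn w, svf s (wordMap T (List.ofFn w)) ≤
      svf s (wordMap T u) * levelSum T s k := by
  rw [Finset.sum_filter,
    sum_ofFn_add fun w => if u <+: w then svf s (wordMap T w) else 0,
    Finset.sum_eq_single u.get]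
  · rw [levelSum, Finset.mul_sum]
    refine Finset.sum_le_sum fun w _ => ?_
    rw [List.ofFn_get, if_pos (List.prefix_append u _), wordMap_append]
    exact svf_mul_le _ _ s
  · intro v _ hv
    refine Finset.sum_eq_zero fun w _ => if_neg fun h => hv (List.ofFn_injective ?_)
    rw [List.ofFn_get]
    exact ((List.prefix_of_prefix_length_le h (List.prefix_append _ _) (by simp)).eq_of_length
      (by simp)).symm
  · simp

/-- Splitting each word of length `n` after the prefix that lies in the cover `A`. -/
theorem levelSum_le_sum_of_cover [Nonempty (Fin M)] {A : Finset (List (Fin M))}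
    (hA : univ ⊆ ⋃ u ∈ A, cylinder u) (hn : ∀ u ∈ A, u.length ≤ n) :
    levelSum T s n ≤ ∑ u ∈ A, svf s (wordMap T u) * levelSum T s (n - u.length) := by
  have exists_prefix (w : Fin n → Fin M) : ∃ u ∈ A, u <+: List.ofFn w := by
    obtain ⟨v, hv⟩ := exists_initWord_eq_ofFn w
    obtain ⟨u, hu, hvu⟩ := mem_iUnion₂.1 (hA (mem_univ v))
    refine ⟨u, hu, ?_⟩
    rw [← hv, ← initWord_length_eq_iff.2 hvu]
    simpa using initWord_prefix v (hn u hu)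
  calc levelSum T s n
      ≤ ∑ w : Fin n → Fin M, ∑ u ∈ A with u <+: List.ofFn w, svf s (wordMap T (List.ofFn w)) := by
        refine Finset.sum_le_sum fun w _ => ?_
        obtain ⟨u, hu, huw⟩ := exists_prefix w
        exact Finset.single_le_sum (f := fun _ => svf s (wordMap T (List.ofFn w)))
          (fun _ _ => svf_nonneg _ s) (Finset.mem_filter.2 ⟨hu, huw⟩)
    _ = ∑ u ∈ A, ∑ w : Fin n → Fin M with u <+: List.ofFn w, svf s (wordMap T (List.ofFn w)) := by
        simp only [Finset.sum_filter]
        exact Finset.sum_comm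
    _ ≤ ∑ u ∈ A, svf s (wordMap T u) * levelSum T s (n - u.length) := by
        refine Finset.sum_le_sum fun u hu => ?_
        obtain ⟨k, rfl⟩ := Nat.exists_eq_add_of_le (hn u hu)
        rw [add_tsub_cancel_left]
        exact sum_svf_of_prefix_le T s u k

theorem bddAbove_range_levelSum_of_cover [Nonempty (Fin M)] {A : Finset (List (Fin M))}
    (hA : univ ⊆ ⋃ u ∈ A, cylinder u) (hlen : ∀ u ∈ A, 1 ≤ u.length)
    (hsum : ∑ u ∈ A, svf s (wordMap T u) ≤ 1) : BddAbove (range (levelSum T s)) := by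
  set K := A.sup List.length
  set B := ∑ j ∈ Finset.range (K + 1), levelSum T s j
  have hB0 : 0 ≤ B := Finset.sum_nonneg fun j _ => levelSum_nonneg T s j
  refine ⟨B, forall_mem_range.2 fun n => ?_⟩
  induction n using Nat.strong_induction_on with
  | _ n ih =>
    obtain hnK | hnK := le_or_gt n K
    · exact Finset.single_le_sum (fun j _ => levelSum_nonneg T s j)
        (Finset.mem_range.2 (Nat.lt_succ_of_le hnK))
    calc levelSum T s n
        ≤ ∑ u ∈ A, svf s (wordMap T u) * levelSum T s (n - u.length) :=
          levelSum_le_sum_of_cover hA fun u hu => (Finset.le_sup hu).trans hnK.le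
      _ ≤ ∑ u ∈ A, svf s (wordMap T u) * B := by
          refine Finset.sum_le_sum fun u hu =>
            mul_le_mul_of_nonneg_left (ih _ ?_) (svf_nonneg _ s)
          have := hlen u hu
          lia
      _ ≤ B := by
          rw [← Finset.sum_mul]
          exact mul_le_of_le_one_left hB0 hsum

theorem growthRate_le_one_of_bddAbove [NeZero d] [Nonempty (Fin M)]
    (hdet : ∀ j, (T j).det ≠ 0) (hT : ‖T‖ ≤ 1) (hs : 0 ≤ s)
    (h : BddAbove (range (levelSum T s))) : growthRate T s ≤ 1 := by
  obtain ⟨B, hB⟩ := h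
  have levelSum_le (n : ℕ) : levelSum T s n ≤ B := hB (mem_range_self n)
  have hB0 : B ≠ 0 := ((levelSum_pos hdet s 0).trans_le (levelSum_le 0)).ne'
  have tendsto_one : Tendsto (fun k : ℕ => B ^ (1 / (k : ℝ))) atTop (𝓝 1) := by
    simpa using (tendsto_const_nhds (x := B)).rpow
      (tendsto_one_div_atTop_nhds_zero_nat (𝕜 := ℝ)) (Or.inl hB0)
  exact le_of_tendsto_of_tendsto' (tendsto_growthRate hdet hT hs) tendsto_one fun k =>
    Real.rpow_le_rpow (levelSum_nonneg T s k) (levelSum_le k) (by positivity)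

theorem growthRate_le_one_of_netMeasure_eq_zero [NeZero d] [Nonempty (Fin M)]
    (hdet : ∀ j, (T j).det ≠ 0) (hT : ‖T‖ ≤ 1) (hs : 0 ≤ s) (h : netMeasure T s univ = 0) :
    growthRate T s ≤ 1 := by
  have netPremeasure_lt_one : netPremeasure T s 1 univ < ENNReal.ofReal 1 :=
    ((netPremeasure_le_netMeasure T s 1 univ).trans_eq h).trans_lt (by simp)
  obtain ⟨A, hlen, hA, hsum⟩ :=
    exists_finset_cover_of_netPremeasure_lt zero_le_one netPremeasure_lt_one
  exact growthRate_le_one_of_bddAbove hdet hT hs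
    (bddAbove_range_levelSum_of_cover hA hlen hsum)

theorem netPremeasure_le_mul [NeZero d] (hT : ‖T‖ ≤ 1) (hs : 0 ≤ s) (hst : s ≤ t) {c : ℝ≥0∞}
    (hc : netPremeasure T s k G < c) :
    netPremeasure T t k G ≤ ENNReal.ofReal (‖T‖ ^ (t - s)) ^ k * c := by
  obtain ⟨A, hA, hG, hlt⟩ := exists_tsum_lt_of_netPremeasure_lt hc
  have hq0 : 0 ≤ ‖T‖ ^ (t - s) := Real.rpow_nonneg (norm_nonneg T) _
  have hq1 : ‖T‖ ^ (t - s) ≤ 1 := Real.rpow_le_one (norm_nonneg T) hT (sub_nonneg.2 hst)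
  calc netPremeasure T t k G ≤ ∑' u : A, ENNReal.ofReal (svf t (wordMap T u)) :=
        netPremeasure_le_tsum hA hG
    _ ≤ ∑' u : A, ENNReal.ofReal (‖T‖ ^ (t - s)) ^ k * ENNReal.ofReal (svf s (wordMap T u)) := by
        refine ENNReal.tsum_le_tsum fun u => ?_
        rw [← ENNReal.ofReal_pow hq0, ← ENNReal.ofReal_mul (pow_nonneg hq0 _), mul_comm]
        exact ENNReal.ofReal_le_ofReal ((svf_wordMap_le T hs hst u).trans
          (mul_le_mul_of_nonneg_left (pow_le_pow_of_le_one hq0 hq1 (hA u u.2)) (svf_nonneg _ s)))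
    _ ≤ ENNReal.ofReal (‖T‖ ^ (t - s)) ^ k * c := by
        rw [ENNReal.tsum_mul_left]
        gcongr

theorem netMeasure_eq_zero_of_ne_top [NeZero d] (hT : ‖T‖ < 1) (hs : 0 ≤ s) (hst : s < t)
    (h : netMeasure T s G ≠ ∞) : netMeasure T t G = 0 := by
  refine le_antisymm (iSup_le fun k => ?_) bot_le
  have ratio_lt_one : ENNReal.ofReal (‖T‖ ^ (t - s)) < 1 := by
    rw [← ENNReal.ofReal_one, ENNReal.ofReal_lt_ofReal_iff one_pos]
    exact Real.rpow_lt_one (norm_nonneg T) hT (sub_pos.2 hst)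
  have tendsto_zero : Tendsto
      (fun n => ENNReal.ofReal (‖T‖ ^ (t - s)) ^ n * (netMeasure T s G + 1)) atTop (𝓝 0) := by
    simpa using ENNReal.Tendsto.mul_const (ENNReal.tendsto_pow_atTop_nhds_zero_of_lt_one
      ratio_lt_one) (Or.inr (ENNReal.add_ne_top.2 ⟨h, ENNReal.one_ne_top⟩))
  refine ge_of_tendsto tendsto_zero ?_
  filter_upwards [eventually_ge_atTop k] with n hkn
  exact (monotone_netPremeasure T t G hkn).trans (netPremeasure_le_mul hT.le hs hst.le
    ((netPremeasure_le_netMeasure T s n G).trans_lt (ENNReal.lt_add_right h one_ne_zero)))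

end NetMeasure

section CriticalValue

variable {d M : ℕ} {T : Fin M → (E d →L[ℝ] E d)} {s t : ℝ}

theorem isGLB_of_growthRate_eq_one [NeZero d] [Nonempty (Fin M)] (hdet : ∀ j, (T j).det ≠ 0)
    (hT : ‖T‖ < 1) (hs : 0 ≤ s) (h : growthRate T s = 1) :
    IsGLB {s : ℝ | 0 ≤ s ∧ netMeasure T s univ = 0} s := by
  have anti := strictAntiOn_growthRate hdet hT
  refine ⟨fun t ⟨ht0, ht⟩ => ?_, fun b hb => le_of_forall_gt_imp_ge_of_dense fun t hst => ?_⟩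
  · rw [← anti.le_iff_ge ht0 hs, h]
    exact growthRate_le_one_of_netMeasure_eq_zero hdet hT.le ht0 ht
  · have ht0 : 0 ≤ t := hs.trans hst.le
    exact hb ⟨ht0, netMeasure_eq_zero_of_growthRate_lt_one hdet hT.le ht0
      ((anti hs ht0 hst).trans_eq h)⟩

theorem sA_eq_of_growthRate_eq_one [NeZero d] [Nonempty (Fin M)] (hdet : ∀ j, (T j).det ≠ 0)
    (hT : ‖T‖ < 1) (hs : 0 ≤ s) (h : growthRate T s = 1) : sA T = s := by
  refine (isGLB_of_growthRate_eq_one hdet hT hs h).csInf_eq ⟨s + 1, by positivity, ?_⟩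
  exact netMeasure_eq_zero_of_growthRate_lt_one hdet hT.le (by positivity)
    ((strictAntiOn_growthRate hdet hT hs (by positivity : 0 ≤ s + 1) (lt_add_one s)).trans_eq h)

variable (T) in
theorem sA_nonneg : 0 ≤ sA T := Real.sInf_nonneg fun _ hs => hs.1

theorem growthRate_sA [NeZero d] [Nonempty (Fin M)] (hdet : ∀ j, (T j).det ≠ 0) (hT : ‖T‖ < 1) :
    growthRate T (sA T) = 1 := by
  obtain ⟨s, hs, h⟩ := exists_growthRate_eq_one hdet hT
  rwa [sA_eq_of_growthRate_eq_one hdet hT hs h]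

theorem isGLB_sA [NeZero d] [Nonempty (Fin M)] (hdet : ∀ j, (T j).det ≠ 0) (hT : ‖T‖ < 1) :
    IsGLB {s : ℝ | 0 ≤ s ∧ netMeasure T s univ = 0} (sA T) :=
  isGLB_of_growthRate_eq_one hdet hT (sA_nonneg T) (growthRate_sA hdet hT)

theorem isAffinityDim_iff [NeZero d] [Nonempty (Fin M)] (hdet : ∀ j, (T j).det ≠ 0)
    (hT : ‖T‖ < 1) : IsAffinityDim T s ↔ s = sA T := by
  constructor
  · rintro ⟨hs, hlim⟩
    exact (sA_eq_of_growthRate_eq_one hdet hT hs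
      (tendsto_nhds_unique (tendsto_growthRate hdet hT.le hs) hlim)).symm
  · rintro rfl
    exact ⟨sA_nonneg T, growthRate_sA hdet hT ▸ tendsto_growthRate hdet hT.le (sA_nonneg T)⟩

theorem sA_pos [NeZero d] [Nontrivial (Fin M)] (hdet : ∀ j, (T j).det ≠ 0) (hT : ‖T‖ < 1) :
    0 < sA T := by
  refine (sA_nonneg T).lt_of_ne fun h => ?_
  have hM := growthRate_sA hdet hT
  rw [← h, growthRate_zero hdet hT.le, Nat.cast_eq_one] at hM
  exact (Fin.nontrivial_iff_two_le.1 ‹_›).not_gt (by lia)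

theorem netMeasure_eq_zero_of_sA_lt [NeZero d] [Nonempty (Fin M)] (hdet : ∀ j, (T j).det ≠ 0)
    (hT : ‖T‖ < 1) (ht : sA T < t) : netMeasure T t univ = 0 := by
  obtain ⟨s, ⟨hs, hs0⟩, hst⟩ := (isGLB_lt_iff (isGLB_sA hdet hT)).1 ht
  exact netMeasure_eq_zero_of_ne_top hT hs hst (by simp [hs0])

theorem netMeasure_eq_top_of_lt_sA [NeZero d] [Nonempty (Fin M)] (hdet : ∀ j, (T j).det ≠ 0)
    (hT : ‖T‖ < 1) (hs : 0 ≤ s) (h : s < sA T) : netMeasure T s univ = ∞ := by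
  by_contra ne_top
  obtain ⟨t, hst, ht⟩ := exists_between h
  exact ht.not_ge ((isGLB_sA hdet hT).1
    ⟨hs.trans hst.le, netMeasure_eq_zero_of_ne_top hT hs hst ne_top⟩)

theorem isLUB_sA [NeZero d] [Nontrivial (Fin M)] (hdet : ∀ j, (T j).det ≠ 0) (hT : ‖T‖ < 1) :
    IsLUB {s : ℝ | 0 ≤ s ∧ netMeasure T s univ = ∞} (sA T) := by
  refine ⟨fun s ⟨_, hs⟩ => le_of_not_gt fun h => ?_, fun b hb => le_of_not_gt fun h => ?_⟩
  · exact ENNReal.zero_ne_top ((netMeasure_eq_zero_of_sA_lt hdet hT h).symm.trans hs)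
  · obtain ⟨t, hbt, ht⟩ := exists_between (max_lt h (sA_pos hdet hT))
    have ht0 : 0 ≤ t := (le_max_right b 0).trans hbt.le
    exact ((le_max_left b 0).trans_lt hbt).not_ge
      (hb ⟨ht0, netMeasure_eq_top_of_lt_sA hdet hT ht0 ht⟩)

end CriticalValue

section Coding

variable {d M : ℕ} {T : Fin M → (E d →L[ℝ] E d)}

/-- The coding map `π_a(v) = ∑_k T_{v_0 ⋯ v_{k-1}} a_{v_k}`, which parametrizes the attractor by
infinite words. -/
noncomputable def coding (T : Fin M → (E d →L[ℝ] E d)) (a : Fin M → E d) (v : ℕ → Fin M) :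
    E d :=
  ∑' k, wordMap T (initWord v k) (a (v k))

theorem norm_wordMap_initWord_apply_le (T : Fin M → (E d →L[ℝ] E d)) (a : Fin M → E d)
    (v : ℕ → Fin M) (k : ℕ) : ‖wordMap T (initWord v k) (a (v k))‖ ≤ ‖T‖ ^ k * ‖a‖ := by
  have norm_le := norm_wordMap_le T (initWord v k)
  rw [length_initWord] at norm_le
  exact ContinuousLinearMap.le_of_opNorm_le_of_le _ norm_le (norm_le_pi_norm a _)

theorem hasSum_norm_pow_mul (hT : ‖T‖ < 1) (r : ℝ) :
    HasSum (fun k : ℕ => ‖T‖ ^ k * r) ((1 - ‖T‖)⁻¹ * r) :=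
  (hasSum_geometric_of_lt_one (norm_nonneg T) hT).mul_right r

theorem summable_coding (hT : ‖T‖ < 1) (a : Fin M → E d) (v : ℕ → Fin M) :
    Summable fun k => wordMap T (initWord v k) (a (v k)) :=
  .of_norm_bounded (hasSum_norm_pow_mul hT ‖a‖).summable (norm_wordMap_initWord_apply_le T a v)

theorem norm_coding_le (hT : ‖T‖ < 1) (a : Fin M → E d) (v : ℕ → Fin M) :
    ‖coding T a v‖ ≤ (1 - ‖T‖)⁻¹ * ‖a‖ :=
  tsum_of_norm_bounded (hasSum_norm_pow_mul hT ‖a‖) (norm_wordMap_initWord_apply_le T a v)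

theorem coding_eq (hT : ‖T‖ < 1) (a : Fin M → E d) (v : ℕ → Fin M) :
    coding T a v = T (v 0) (coding T a fun n => v (n + 1)) + a (v 0) := by
  rw [coding, (summable_coding hT a v).tsum_eq_zero_add, coding,
    ContinuousLinearMap.map_tsum _ (summable_coding hT a _), add_comm]
  simp [initWord_succ]

theorem coding_sub_coding (hT : ‖T‖ < 1) (a : Fin M → E d) {v w : ℕ → Fin M}
    (k : ℕ) (h : ∀ i < k, v i = w i) :
    coding T a v - coding T a w = wordMap T (initWord v k)
      (coding T a (fun n => v (n + k)) - coding T a fun n => w (n + k)) := by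
  induction k generalizing v w with
  | zero => simp
  | succ k ih =>
    rw [coding_eq hT a v, coding_eq hT a w, ← h 0 (by lia), add_sub_add_right_eq_sub, ← map_sub,
      ih fun i hi => h (i + 1) (by lia), initWord_succ, wordMap_cons]
    simp [add_assoc]

theorem continuous_wordMap_initWord (T : Fin M → (E d →L[ℝ] E d)) (k : ℕ) :
    Continuous fun v : ℕ → Fin M => wordMap T (initWord v k) := by
  have continuous_word : Continuous fun u : Fin k → Fin M => wordMap T (List.ofFn u) :=
    continuous_of_discreteTopology
  exact continuous_word.comp (continuous_pi fun i => continuous_apply _)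

theorem continuous_coding_term (T : Fin M → (E d →L[ℝ] E d)) (k : ℕ) :
    Continuous fun p : (Fin M → E d) × (ℕ → Fin M) =>
      wordMap T (initWord p.2 k) (p.1 (p.2 k)) := by
  have continuous_eval : Continuous fun q : (Fin M → E d) × Fin M => q.1 q.2 :=
    continuous_prod_of_discrete_right.2 fun i => continuous_apply i
  exact ((continuous_wordMap_initWord T k).comp continuous_snd).clm_apply
    (continuous_eval.comp (continuous_fst.prodMk ((continuous_apply k).comp continuous_snd)))

theorem continuous_coding (hT : ‖T‖ < 1) :
    Continuous fun p : (Fin M → E d) × (ℕ → Fin M) => coding T p.1 p.2 := by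
  have continuousOn_ball (r : ℝ) : ContinuousOn
      (fun p : (Fin M → E d) × (ℕ → Fin M) => coding T p.1 p.2) (Metric.ball 0 r ×ˢ univ) := by
    refine continuousOn_tsum (fun k => (continuous_coding_term T k).continuousOn)
      (hasSum_norm_pow_mul hT r).summable fun k p hp => ?_
    refine (norm_wordMap_initWord_apply_le T p.1 p.2 k).trans ?_
    gcongr
    exact (mem_ball_zero_iff.1 hp.1).le
  refine continuous_iff_continuousAt.2 fun p => (continuousOn_ball (‖p.1‖ + 1)).continuousAt ?_
  exact (Metric.isOpen_ball.prod isOpen_univ).mem_nhds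
    ⟨mem_ball_zero_iff.2 (lt_add_one _), mem_univ _⟩

theorem continuous_coding_right (hT : ‖T‖ < 1) (a : Fin M → E d) : Continuous (coding T a) :=
  (continuous_coding hT).comp (continuous_const.prodMk continuous_id)

theorem isAttractor_range_coding [Nonempty (Fin M)] (hT : ‖T‖ < 1) (a : Fin M → E d) :
    IsAttractor T a (range (coding T a)) := by
  refine ⟨range_nonempty _, isCompact_range (continuous_coding_right hT a), ?_⟩
  ext x
  simp only [mem_range, mem_iUnion, mem_image, exists_exists_eq_and]
  constructor
  · rintro ⟨v, rfl⟩
    exact ⟨v 0, fun n => v (n + 1), (coding_eq hT a v).symm⟩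
  · rintro ⟨i, v, rfl⟩
    exact ⟨consWord i v, coding_eq hT a _⟩

theorem IsAttractor.infDist_le {a : Fin M → E d} {G : Set (E d)} (hG : IsAttractor T a G)
    (i : Fin M) (y : E d) :
    Metric.infDist (T i y + a i) G ≤ ‖T‖ * Metric.infDist y G := by
  obtain ⟨z, hz, hyz⟩ := hG.2.1.exists_infDist_eq_dist hG.1 y
  have image_mem : T i z + a i ∈ G := by
    rw [hG.2.2]
    exact mem_iUnion.2 ⟨i, z, hz, rfl⟩
  calc Metric.infDist (T i y + a i) G ≤ dist (T i y + a i) (T i z + a i) :=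
        Metric.infDist_le_dist_of_mem image_mem
    _ = ‖T i (y - z)‖ := by rw [dist_add_right, dist_eq_norm, map_sub]
    _ ≤ ‖T‖ * ‖y - z‖ := (T i).le_of_opNorm_le (norm_le_pi_norm T i) _
    _ = ‖T‖ * Metric.infDist y G := by rw [hyz, dist_eq_norm]

theorem IsAttractor.subset (hT : ‖T‖ < 1) {a : Fin M → E d} {F G : Set (E d)}
    (hF : IsAttractor T a F) (hG : IsAttractor T a G) : F ⊆ G := by
  obtain ⟨x, hx, hmax⟩ := hF.2.1.exists_isMaxOn hF.1 (Metric.continuous_infDist_pt G).continuousOn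
  obtain ⟨i, y, hy, rfl⟩ := mem_iUnion.1 (hF.2.2 ▸ hx)
  have contraction := hG.infDist_le i y
  have le_max : Metric.infDist y G ≤ Metric.infDist (T i y + a i) G := hmax hy
  have infDist_eq_zero : Metric.infDist y G = 0 := by
    nlinarith [Metric.infDist_nonneg (x := y) (s := G)]
  intro w hw
  have le_max' : Metric.infDist w G ≤ Metric.infDist (T i y + a i) G := hmax hw
  rw [infDist_eq_zero, mul_zero] at contraction
  exact (hG.2.1.isClosed.mem_iff_infDist_zero hG.1).2
    ((le_max'.trans contraction).antisymm Metric.infDist_nonneg)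

theorem IsAttractor.eq_range_coding [Nonempty (Fin M)] (hT : ‖T‖ < 1) {a : Fin M → E d}
    {F : Set (E d)} (hF : IsAttractor T a F) : F = range (coding T a) :=
  (hF.subset hT (isAttractor_range_coding hT a)).antisymm
    ((isAttractor_range_coding hT a).subset hT hF)

end Coding

section UpperBound

theorem abs_sub_le_of_floor_eq {x y R δ : ℝ} (hδ : 0 < δ) (hx : |x| ≤ R) (hy : |y| ≤ R)
    (h : ⌊(x + R) / δ⌋₊ = ⌊(y + R) / δ⌋₊) : |x - y| ≤ δ := by
  have key := Int.abs_sub_lt_one_of_floor_eq_floor (a := (x + R) / δ) (b := (y + R) / δ) <| by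
    have hx0 : 0 ≤ (x + R) / δ := div_nonneg (by linarith [abs_le.1 hx]) hδ.le
    have hy0 : 0 ≤ (y + R) / δ := div_nonneg (by linarith [abs_le.1 hy]) hδ.le
    rw [← Int.natCast_floor_eq_floor hx0, ← Int.natCast_floor_eq_floor hy0, h]
  rw [← sub_div, add_sub_add_right_eq_sub, abs_div, abs_of_pos hδ, div_lt_one hδ] at key
  exact key.le

theorem exists_finset_cover_abs_sub_le {X κ : Type*} [Fintype κ] {S : Set X} {f : κ → X → ℝ}
    {R : ℝ} {δ : κ → ℝ} (hR : 0 ≤ R) (hf : ∀ i, ∀ x ∈ S, |f i x| ≤ R) (hδ : ∀ i, 0 < δ i)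
    (hδ1 : ∀ i, δ i ≤ 1) :
    ∃ 𝓑 : Finset (Set X), S ⊆ ⋃ B ∈ 𝓑, B ∧ (𝓑.card : ℝ) ≤ ∏ i, (2 * R + 1) / δ i ∧
      ∀ B ∈ 𝓑, ∀ x ∈ B, ∀ y ∈ B, ∀ i, |f i x - f i y| ≤ δ i := by
  classical
  let n (i : κ) : ℕ := ⌊2 * R / δ i⌋₊ + 1
  let box (j : ∀ i, Fin (n i)) : Set X := {x ∈ S | ∀ i, ⌊(f i x + R) / δ i⌋₊ = j i}
  refine ⟨Finset.univ.image box, fun x hx => ?_, ?_, ?_⟩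
  · have index_lt (i : κ) : ⌊(f i x + R) / δ i⌋₊ < n i := by
      refine Nat.lt_succ_of_le (Nat.floor_le_floor ?_)
      have := (abs_le.1 (hf i x hx)).2
      exact div_le_div_of_nonneg_right (by linarith) (hδ i).le
    simpa using ⟨fun i => ⟨_, index_lt i⟩, hx, fun i => rfl⟩
  · calc ((Finset.univ.image box).card : ℝ) ≤ Fintype.card (∀ i, Fin (n i)) := by
          exact_mod_cast Finset.card_image_le
      _ = ∏ i, (n i : ℝ) := by simp
      _ ≤ ∏ i, (2 * R + 1) / δ i := by
          refine Finset.prod_le_prod (fun i _ => Nat.cast_nonneg _) fun i _ => ?_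
          have floor_le : (⌊2 * R / δ i⌋₊ : ℝ) ≤ 2 * R / δ i :=
            Nat.floor_le (div_nonneg (by positivity) (hδ i).le)
          have one_le : 1 ≤ 1 / δ i := (one_le_div (hδ i)).2 (hδ1 i)
          rw [add_div, Nat.cast_succ]
          exact add_le_add floor_le one_le
  · simp only [Finset.mem_image, Finset.mem_univ, true_and, forall_exists_index]
    rintro _ j rfl x ⟨hx, hxj⟩ y ⟨hy, hyj⟩ i
    exact abs_sub_le_of_floor_eq (hδ i) (hf i x hx) (hf i y hy) ((hxj i).trans (hyj i).symm)

theorem IsRightSingularBasis.norm_apply_le {V W : Type*} [NormedAddCommGroup V]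
    [InnerProductSpace ℝ V] [FiniteDimensional ℝ V] [NormedAddCommGroup W]
    [InnerProductSpace ℝ W] [FiniteDimensional ℝ W] {n : ℕ} {T : V →ₗ[ℝ] W}
    {e : OrthonormalBasis (Fin n) ℝ V} (he : IsRightSingularBasis T e) {x : V} {r : ℝ}
    (h : ∀ i : Fin n, T.singularValues i * |e.repr x i| ≤ r) : ‖T x‖ ≤ n * r := by
  obtain rfl | hn := n.eq_zero_or_pos
  · have : ‖T x‖ ^ 2 = 0 := by simp [he.norm_sq_apply]
    simpa using this
  have hr : 0 ≤ r :=
    (mul_nonneg (T.singularValues_nonneg _) (abs_nonneg _)).trans (h ⟨0, hn⟩)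
  refine le_of_sq_le_sq ?_ (by positivity)
  calc ‖T x‖ ^ 2 = ∑ i : Fin n, (T.singularValues i * |e.repr x i|) ^ 2 := by
        simp only [he.norm_sq_apply, mul_pow, sq_abs]
    _ ≤ ∑ _i : Fin n, r ^ 2 := Finset.sum_le_sum fun i _ =>
        pow_le_pow_left₀ (mul_nonneg (T.singularValues_nonneg _) (abs_nonneg _)) (h i) 2
    _ = n * r ^ 2 := by simp
    _ ≤ (n * r) ^ 2 := by
        rw [mul_pow]
        have : (1 : ℝ) ≤ n := by exact_mod_cast hn
        gcongr
        nlinarith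

variable {d M : ℕ} {T : Fin M → (E d →L[ℝ] E d)}

theorem prod_max_one_singVal_div (T : E d →L[ℝ] E d) {k : ℕ} (hk : k ≤ d)
    (hpos : 0 < singVal T k) :
    ∏ i ∈ Finset.range d, max 1 (singVal T i / singVal T k) =
      (∏ i ∈ Finset.range k, singVal T i) / singVal T k ^ k := by
  rw [← Finset.prod_subset (Finset.range_mono hk)]
  · trans ∏ i ∈ Finset.range k, singVal T i / singVal T k
    · refine Finset.prod_congr rfl fun i hi => max_eq_right ?_
      exact (one_le_div hpos).2 (singVal_antitone T (Finset.mem_range.1 hi).le)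
    · rw [Finset.prod_div_distrib, Finset.prod_const, Finset.card_range]
  · intro i _ hi
    refine max_eq_left ((div_le_one hpos).2 (singVal_antitone T ?_))
    simpa using hi

/-- The image of a ball is an ellipsoid with semi-axes proportional to the singular values; it is
cut into boxes whose sides are at most the singular value number `k`. -/
theorem exists_finset_cover_image_closedBall (T : E d →L[ℝ] E d) {k : ℕ} (hk : k ≤ d)
    (hpos : 0 < singVal T k) {R : ℝ} (hR : 0 ≤ R) (z : E d) :
    ∃ 𝓑 : Finset (Set (E d)), (fun x => z + T x) '' Metric.closedBall 0 R ⊆ ⋃ B ∈ 𝓑, B ∧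
      (∀ B ∈ 𝓑, Metric.ediam B ≤ ENNReal.ofReal (d * singVal T k)) ∧
      (𝓑.card : ℝ) ≤ (2 * R + 1) ^ d *
        ((∏ i ∈ Finset.range k, singVal T i) / singVal T k ^ k) := by
  classical
  obtain ⟨e, he⟩ := exists_isRightSingularBasis (T : E d →ₗ[ℝ] E d) finrank_euclideanSpace_fin
  let ratio (i : Fin d) : ℝ := max 1 (singVal T i / singVal T k)
  have ratio_pos (i : Fin d) : 0 < ratio i := one_pos.trans_le (le_max_left _ _)
  have repr_le (i : Fin d) (x : E d) (hx : x ∈ Metric.closedBall 0 R) : |e.repr x i| ≤ R :=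
    calc |e.repr x i| ≤ ‖e.repr x‖ := PiLp.norm_apply_le (e.repr x) i
      _ ≤ R := by simpa using hx
  obtain ⟨𝓑, hcover, hcard, hB⟩ := exists_finset_cover_abs_sub_le hR repr_le
    (fun i => inv_pos.2 (ratio_pos i)) fun i => inv_le_one_of_one_le₀ (le_max_left _ _)
  refine ⟨𝓑.image ((fun x => z + T x) '' ·), ?_, ?_, ?_⟩
  · rintro _ ⟨x, hx, rfl⟩
    obtain ⟨B, hB𝓑, hxB⟩ := mem_iUnion₂.1 (hcover hx)
    exact mem_iUnion₂.2 ⟨_, Finset.mem_image_of_mem _ hB𝓑, x, hxB, rfl⟩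
  · simp only [Finset.mem_image, forall_exists_index, and_imp]
    rintro _ B hB𝓑 rfl
    refine Metric.ediam_le ?_
    rintro _ ⟨x, hx, rfl⟩ _ ⟨y, hy, rfl⟩
    rw [edist_dist, dist_add_left, dist_eq_norm, ← map_sub]
    refine ENNReal.ofReal_le_ofReal (he.norm_apply_le (x := x - y) fun i => ?_)
    have abs_le : |e.repr (x - y) i| ≤ (ratio i)⁻¹ := by simpa using hB B hB𝓑 x hx y hy i
    calc singVal T i * |e.repr (x - y) i| ≤ singVal T i * (ratio i)⁻¹ :=
          mul_le_mul_of_nonneg_left abs_le (singVal_nonneg T i)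
      _ ≤ singVal T k := by
          rw [mul_inv_le_iff₀ (ratio_pos i), ← div_le_iff₀' hpos]
          exact le_max_right _ _
  · calc ((𝓑.image ((fun x => z + T x) '' ·)).card : ℝ) ≤ 𝓑.card := by
          exact_mod_cast Finset.card_image_le
      _ ≤ ∏ i, (2 * R + 1) / (ratio i)⁻¹ := hcard
      _ = (2 * R + 1) ^ d * ∏ i : Fin d, ratio i := by simp [Finset.prod_mul_distrib]
      _ = _ := by
        rw [Fin.prod_univ_eq_prod_range fun i => max 1 (singVal T i / singVal T k),
          prod_max_one_singVal_div T hk hpos]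

theorem exists_finset_cover_image_closedBall_sum_le {T : E d →L[ℝ] E d} (hT : T.det ≠ 0) {t : ℝ}
    (ht : 0 < t) (htd : t ≤ d) {R : ℝ} (hR : 0 ≤ R) (z : E d) :
    ∃ 𝓑 : Finset (Set (E d)), (fun x => z + T x) '' Metric.closedBall 0 R ⊆ ⋃ B ∈ 𝓑, B ∧
      (∀ B ∈ 𝓑, Metric.ediam B ≤ ENNReal.ofReal (d * ‖T‖)) ∧
      ∑ B ∈ 𝓑, Metric.ediam B ^ t ≤ ENNReal.ofReal ((2 * R + 1) ^ d * (d : ℝ) ^ t * svf t T) := by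
  obtain ⟨k, hkd, htk⟩ := exists_nat_mem_Ioc ht htd
  have hpos : 0 < singVal T k := singVal_pos hT hkd
  obtain ⟨𝓑, hcover, hdiam, hcard⟩ :=
    exists_finset_cover_image_closedBall T (Nat.le_of_succ_le hkd) hpos hR z
  refine ⟨𝓑, hcover, fun B hB => (hdiam B hB).trans ?_, ?_⟩
  · gcongr
    exact singVal_le_norm T k
  calc ∑ B ∈ 𝓑, Metric.ediam B ^ t
      ≤ ∑ _B ∈ 𝓑, ENNReal.ofReal ((d * singVal T k) ^ t) := by
        refine Finset.sum_le_sum fun B hB => ?_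
        rw [← ENNReal.ofReal_rpow_of_nonneg (by positivity) ht.le]
        exact ENNReal.rpow_le_rpow (hdiam B hB) ht.le
    _ = ENNReal.ofReal (𝓑.card * (d * singVal T k) ^ t) := by
        rw [Finset.sum_const, nsmul_eq_mul, ENNReal.ofReal_mul (Nat.cast_nonneg _),
          ENNReal.ofReal_natCast]
    _ ≤ ENNReal.ofReal ((2 * R + 1) ^ d * ((∏ i ∈ Finset.range k, singVal T i) /
          singVal T k ^ k) * (d * singVal T k) ^ t) := by gcongr
    _ = _ := by
        rw [svf_of_mem_Ioc T htk hkd, Real.mul_rpow (Nat.cast_nonneg d) hpos.le,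
          Real.rpow_sub hpos, Real.rpow_natCast]
        ring_nf

theorem coding_image_cylinder_subset [Nonempty (Fin M)] (hT : ‖T‖ < 1) (a : Fin M → E d)
    (u : List (Fin M)) : ∃ z, coding T a '' cylinder u ⊆ (fun x => z + wordMap T u x) ''
      Metric.closedBall 0 (2 * ((1 - ‖T‖)⁻¹ * ‖a‖)) := by
  obtain ⟨v, hv⟩ := cylinder_nonempty u
  refine ⟨coding T a v, ?_⟩
  rintro _ ⟨w, hw, rfl⟩
  refine ⟨coding T a (fun n => w (n + u.length)) - coding T a fun n => v (n + u.length), ?_, ?_⟩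
  · rw [mem_closedBall_zero_iff, two_mul]
    exact (norm_sub_le _ _).trans (add_le_add (norm_coding_le hT a _) (norm_coding_le hT a _))
  · have h := coding_sub_coding hT a (v := w) (w := v) u.length fun i hi =>
      (hw i hi).trans (hv i hi).symm
    rw [initWord_length_eq_iff.2 hw] at h
    simp [← h]

theorem exists_finset_cover_coding_cylinder [Nonempty (Fin M)] (hdet : ∀ j, (T j).det ≠ 0)
    (hT : ‖T‖ < 1) {t : ℝ} (ht : 0 < t) (htd : t ≤ d) (a : Fin M → E d) :
    ∃ C : ℝ, 0 ≤ C ∧ ∀ u, ∃ 𝓑 : Finset (Set (E d)), coding T a '' cylinder u ⊆ ⋃ B ∈ 𝓑, B ∧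
      (∀ B ∈ 𝓑, Metric.ediam B ≤ ENNReal.ofReal (d * ‖T‖ ^ u.length)) ∧
      ∑ B ∈ 𝓑, Metric.ediam B ^ t ≤ ENNReal.ofReal (C * svf t (wordMap T u)) := by
  have hR : 0 ≤ 2 * ((1 - ‖T‖)⁻¹ * ‖a‖) := by
    have := sub_pos.2 hT
    positivity
  refine ⟨(2 * (2 * ((1 - ‖T‖)⁻¹ * ‖a‖)) + 1) ^ d * (d : ℝ) ^ t, by positivity, fun u => ?_⟩
  obtain ⟨z, hz⟩ := coding_image_cylinder_subset hT a u
  obtain ⟨𝓑, hcover, hdiam, hsum⟩ := exists_finset_cover_image_closedBall_sum_le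
    (det_wordMap_ne_zero hdet u) ht htd hR z
  refine ⟨𝓑, hz.trans hcover, fun B hB => (hdiam B hB).trans ?_, hsum⟩
  gcongr
  exact norm_wordMap_le T u

theorem range_coding_subset_iUnion (T : Fin M → (E d →L[ℝ] E d)) (a : Fin M → E d) (n : ℕ) :
    range (coding T a) ⊆ ⋃ u : Fin n → Fin M, coding T a '' cylinder (List.ofFn u) := by
  rintro _ ⟨v, rfl⟩
  exact mem_iUnion.2 ⟨fun i => v i, v, mem_cylinder_initWord v n, rfl⟩

theorem hausdorffMeasure_range_coding_eq_zero [NeZero d] [Nonempty (Fin M)]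
    (hdet : ∀ j, (T j).det ≠ 0) (hT : ‖T‖ < 1) {t : ℝ} (ht : 0 < t) (htd : t ≤ d)
    (h : growthRate T t < 1) (a : Fin M → E d) : μH[t] (range (coding T a)) = 0 := by
  obtain ⟨C, hC, hcov⟩ := exists_finset_cover_coding_cylinder hdet hT ht htd a
  choose 𝓑 hcover hdiam hsum using hcov
  have diam_tendsto : Tendsto (fun n : ℕ => ENNReal.ofReal (d * ‖T‖ ^ n)) atTop (𝓝 0) := by
    simpa using ENNReal.tendsto_ofReal
      ((tendsto_pow_atTop_nhds_zero_of_lt_one (norm_nonneg T) hT).const_mul (d : ℝ))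
  have sum_tendsto : Tendsto (fun n => ENNReal.ofReal (C * levelSum T t n)) atTop (𝓝 0) := by
    simpa using ENNReal.tendsto_ofReal ((tendsto_levelSum_zero hdet hT.le ht.le h).const_mul C)
  refine nonpos_iff_eq_zero.1 ((Measure.hausdorffMeasure_le_liminf_sum t _ _ diam_tendsto
    (fun n (p : Σ u : Fin n → Fin M, ↥(𝓑 (List.ofFn u))) => (p.2 : Set (E d))) ?_ ?_).trans
    (liminf_le_liminf (Eventually.of_forall fun n => ?_) |>.trans_eq sum_tendsto.liminf_eq))
  · exact Eventually.of_forall fun n p => by simpa using hdiam _ _ p.2.2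
  · refine Eventually.of_forall fun n x hx => ?_
    obtain ⟨u, hu⟩ := mem_iUnion.1 (range_coding_subset_iUnion T a n hx)
    obtain ⟨B, hB, hxB⟩ := mem_iUnion₂.1 (hcover _ hu)
    exact mem_iUnion.2 ⟨⟨u, B, hB⟩, hxB⟩
  · rw [levelSum, Finset.mul_sum, ENNReal.ofReal_sum_of_nonneg fun _ _ =>
      mul_nonneg hC (svf_nonneg _ _), Fintype.sum_sigma]
    refine Finset.sum_le_sum fun u _ => ?_
    rw [Finset.sum_coe_sort (𝓑 (List.ofFn u)) fun B => Metric.ediam B ^ t]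
    exact hsum _

theorem dimH_range_coding_le [NeZero d] [Nontrivial (Fin M)] (hdet : ∀ j, (T j).det ≠ 0)
    (hT : ‖T‖ < 1) (h : sA T ≤ d) (a : Fin M → E d) :
    dimH (range (coding T a)) ≤ ENNReal.ofReal (sA T) := by
  obtain h | h := h.eq_or_lt
  · rw [h, ENNReal.ofReal_natCast]
    refine (dimH_mono (subset_univ _)).trans ?_
    simp [Real.dimH_univ_eq_finrank]
  have tendsto_ofReal : Tendsto ENNReal.ofReal (𝓝[>] (sA T)) (𝓝 (ENNReal.ofReal (sA T))) :=
    (ENNReal.continuous_ofReal.tendsto _).mono_left nhdsWithin_le_nhds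
  refine ge_of_tendsto tendsto_ofReal ?_
  filter_upwards [Ioc_mem_nhdsGT h] with t ⟨hst, htd⟩
  have ht : 0 < t := (sA_pos hdet hT).trans hst
  have growth_lt : growthRate T t < 1 :=
    (strictAntiOn_growthRate hdet hT (sA_nonneg T) ht.le hst).trans_eq (growthRate_sA hdet hT)
  refine dimH_le_of_hausdorffMeasure_ne_top (d := t.toNNReal) ?_
  rw [Real.coe_toNNReal _ ht.le, hausdorffMeasure_range_coding_eq_zero hdet hT ht htd growth_lt]
  exact ENNReal.zero_ne_top

end UpperBound

section Frostman

variable {d M : ℕ} {T : Fin M → (E d →L[ℝ] E d)} {s : ℝ}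

/-- The measure is distributed successively over the sub-cylinders of each cylinder, in
proportion to `f`. -/
theorem exists_measure_cylinder_le_of_length_le [Nonempty (Fin M)] {f : List (Fin M) → ℝ≥0∞}
    (hf : ∀ u, f u ≤ ∑ i, f (u ++ [i])) (hfin : ∀ u, f u ≠ ∞) (N : ℕ) :
    ∃ ν : Measure (ℕ → Fin M), ν univ = f [] ∧
      ∀ u : List (Fin M), u.length ≤ N → ν (cylinder u) ≤ f u := by
  induction N generalizing f with
  | zero =>
    refine ⟨f [] • Measure.dirac (Classical.arbitrary _), by simp, fun u hu => ?_⟩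
    obtain rfl := List.eq_nil_of_length_eq_zero (Nat.le_zero.1 hu)
    simp
  | succ N ih =>
    choose ν hν_univ hν_le using fun i => ih (f := fun u => f (i :: u)) (fun u => hf (i :: u))
      fun u => hfin (i :: u)
    have f_nil_le : f [] ≤ ∑ i, f [i] := hf []
    have scale_le_one : f [] / ∑ i, f [i] ≤ 1 := ENNReal.div_le_of_le_mul (by rwa [one_mul])
    have total_mass : ((f [] / ∑ i, f [i]) • ∑ i, (ν i).map (consWord i)) univ = f [] := by
      simp only [Measure.smul_apply, Measure.finsetSum_apply, smul_eq_mul,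
        Measure.map_apply (measurable_consWord _) MeasurableSet.univ, preimage_univ, hν_univ]
      obtain h0 | h0 := eq_or_ne (∑ i, f [i]) 0
      · rw [h0, mul_zero, nonpos_iff_eq_zero.1 (f_nil_le.trans h0.le)]
      · exact ENNReal.div_mul_cancel h0 (ENNReal.sum_ne_top.2 fun i _ => hfin _)
    refine ⟨_, total_mass, fun u hu => ?_⟩
    cases u with
    | nil => rw [cylinder_nil, total_mass]
    | cons i u =>
      have map_consWord_of_ne (j : Fin M) (hj : j ≠ i) :
          (ν j).map (consWord j) (cylinder (i :: u)) = 0 := by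
        rw [Measure.map_apply (measurable_consWord j) (measurableSet_cylinder _)]
        convert measure_empty (μ := ν j)
        exact eq_empty_of_forall_notMem fun v hv => hj (consWord_mem_cylinder_cons_iff.1 hv).1
      have map_consWord_self : (ν i).map (consWord i) (cylinder (i :: u)) ≤ f (i :: u) := by
        rw [Measure.map_apply (measurable_consWord i) (measurableSet_cylinder _)]
        exact (measure_mono fun v hv => (consWord_mem_cylinder_cons_iff.1 hv).2).trans
          (hν_le i u (by simpa using hu))
      rw [Measure.smul_apply, smul_eq_mul]
      refine (mul_le_of_le_one_left bot_le scale_le_one).trans ?_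
      rwa [Measure.finsetSum_apply, Fintype.sum_eq_single i map_consWord_of_ne]

theorem exists_isProbabilityMeasure_cylinder_le [Nonempty (Fin M)] {f : List (Fin M) → ℝ≥0∞}
    (hf : ∀ u, f u ≤ ∑ i, f (u ++ [i])) (hfin : ∀ u, f u ≠ ∞) (h0 : f [] ≠ 0) :
    ∃ μ : Measure (ℕ → Fin M), IsProbabilityMeasure μ ∧
      ∀ u, μ (cylinder u) ≤ (f [])⁻¹ * f u := by
  choose ν hν_univ hν_le using exists_measure_cylinder_le_of_length_le hf hfin
  let P (N : ℕ) : ProbabilityMeasure (ℕ → Fin M) := ⟨(f [])⁻¹ • ν N, ⟨by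
    rw [Measure.smul_apply, hν_univ, smul_eq_mul, ENNReal.inv_mul_cancel h0 (hfin _)]⟩⟩
  obtain ⟨Q, -, hQ⟩ := isCompact_univ.ultrafilter_le_nhds
    (Ultrafilter.map P (hyperfilter ℕ)) (by simp)
  refine ⟨Q, inferInstance, fun u => ?_⟩
  have tendsto_cylinder := ProbabilityMeasure.tendsto_measure_of_null_frontier_of_tendsto'
    (show Tendsto P (hyperfilter ℕ) (𝓝 Q) from hQ) (E := cylinder u)
    (by simp [(isClopen_cylinder u).frontier_eq])
  refine le_of_tendsto tendsto_cylinder ?_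
  filter_upwards [Nat.hyperfilter_le_atTop (eventually_ge_atTop u.length)] with N hN
  exact mul_le_mul_right (hν_le N u hN) _

theorem netPremeasure_cylinder_le (T : Fin M → (E d →L[ℝ] E d)) (s : ℝ) (u : List (Fin M)) :
    netPremeasure T s 0 (cylinder u) ≤ ENNReal.ofReal (svf s (wordMap T u)) := by
  refine (netPremeasure_le_tsum (A := {u}) (by simp) (by simp)).trans_eq ?_
  rw [tsum_singleton u fun v => ENNReal.ofReal (svf s (wordMap T v))]

theorem netPremeasure_cylinder_ne_top (T : Fin M → (E d →L[ℝ] E d)) (s : ℝ)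
    (u : List (Fin M)) : netPremeasure T s 0 (cylinder u) ≠ ∞ :=
  ((netPremeasure_cylinder_le T s u).trans_lt ENNReal.ofReal_lt_top).ne

theorem netPremeasure_mono (T : Fin M → (E d →L[ℝ] E d)) (s : ℝ) (k : ℕ)
    {G H : Set (ℕ → Fin M)} (h : G ⊆ H) : netPremeasure T s k G ≤ netPremeasure T s k H :=
  le_iInf₂ fun A hA => iInf₂_le A ⟨hA.1, h.trans hA.2⟩

theorem netPremeasure_empty (T : Fin M → (E d →L[ℝ] E d)) (s : ℝ) (k : ℕ) :
    netPremeasure T s k ∅ = 0 :=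
  nonpos_iff_eq_zero.1
    ((netPremeasure_le_tsum (A := ∅) (by simp) (empty_subset _)).trans_eq tsum_empty)

theorem netPremeasure_union_le (T : Fin M → (E d →L[ℝ] E d)) (s : ℝ) (k : ℕ)
    (G H : Set (ℕ → Fin M)) :
    netPremeasure T s k (G ∪ H) ≤ netPremeasure T s k G + netPremeasure T s k H := by
  rw [netPremeasure.eq_def T s k G, netPremeasure.eq_def T s k H]
  simp only [ENNReal.iInf_add, ENNReal.add_iInf]
  refine le_iInf₂ fun A hA => le_iInf₂ fun B hB => ?_
  refine (netPremeasure_le_tsum (A := B ∪ A) (fun v hv => hv.elim (hB.1 v) (hA.1 v)) ?_).trans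
    (ENNReal.tsum_union_le (fun v => ENNReal.ofReal (svf s (wordMap T v))) B A)
  rw [biUnion_union]
  exact union_subset_union hB.2 hA.2

theorem netPremeasure_iUnion_le (T : Fin M → (E d →L[ℝ] E d)) (s : ℝ) (k : ℕ) {ι : Type*}
    [Fintype ι] (G : ι → Set (ℕ → Fin M)) :
    netPremeasure T s k (⋃ i, G i) ≤ ∑ i, netPremeasure T s k (G i) := by
  classical
  suffices ∀ A : Finset ι, netPremeasure T s k (⋃ i ∈ A, G i) ≤
      ∑ i ∈ A, netPremeasure T s k (G i) by simpa using this Finset.univ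
  intro A
  induction A using Finset.induction_on with
  | empty => simp [netPremeasure_empty]
  | insert i A hi ih =>
    rw [Finset.sum_insert hi, Finset.set_biUnion_insert]
    exact (netPremeasure_union_le T s k _ _).trans (add_le_add_right ih _)

theorem exists_pos_le_svf_wordMap (hdet : ∀ j, (T j).det ≠ 0) (s : ℝ) (k : ℕ) :
    ∃ c : ℝ, 0 < c ∧ ∀ u : List (Fin M), u.length ≤ k → c ≤ svf s (wordMap T u) := by
  obtain ⟨u, -, hu⟩ := exists_min_image {u : List (Fin M) | u.length ≤ k}
    (fun u => svf s (wordMap T u)) (List.finite_length_le _ k) ⟨[], Nat.zero_le k⟩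
  exact ⟨_, svf_pos (det_wordMap_ne_zero hdet u) s, hu⟩

/-- Words of bounded length cannot take part in covers with small sum. -/
theorem netMeasure_eq_zero_of_netPremeasure_eq_zero (hdet : ∀ j, (T j).det ≠ 0)
    {G : Set (ℕ → Fin M)} (h : netPremeasure T s 0 G = 0) : netMeasure T s G = 0 := by
  refine le_antisymm (iSup_le fun k => le_of_forall_pos_le_add fun ε hε => ?_) bot_le
  obtain ⟨c, hc, hcT⟩ := exists_pos_le_svf_wordMap hdet s k
  obtain ⟨A, -, hcover, hsum⟩ := exists_tsum_lt_of_netPremeasure_lt (c := min ε (ENNReal.ofReal c))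
    (h ▸ lt_min hε (ENNReal.ofReal_pos.2 hc))
  rw [zero_add]
  refine (netPremeasure_le_tsum (fun u hu => ?_) hcover).trans (hsum.le.trans (min_le_left _ _))
  by_contra! length_lt
  have term_lt : ENNReal.ofReal (svf s (wordMap T u)) < ENNReal.ofReal c :=
    ((ENNReal.le_tsum (f := fun u : A => ENNReal.ofReal (svf s (wordMap T u)))
      ⟨u, hu⟩).trans_lt hsum).trans_le (min_le_right _ _)
  exact ((ENNReal.ofReal_lt_ofReal_iff hc).1 term_lt).not_ge (hcT u length_lt.le)

theorem exists_frostman_measure [NeZero d] [Nonempty (Fin M)] (hdet : ∀ j, (T j).det ≠ 0)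
    (hT : ‖T‖ < 1) (hs : 0 ≤ s) (h : s < sA T) :
    ∃ μ : Measure (ℕ → Fin M), IsProbabilityMeasure μ ∧ ∃ K : ℝ≥0∞, K ≠ ∞ ∧
      ∀ u, μ (cylinder u) ≤ K * ENNReal.ofReal (svf s (wordMap T u)) := by
  have subadditive (u : List (Fin M)) :
      netPremeasure T s 0 (cylinder u) ≤ ∑ i, netPremeasure T s 0 (cylinder (u ++ [i])) :=
    (netPremeasure_mono T s 0 (cylinder_subset_iUnion_append u)).trans
      (netPremeasure_iUnion_le T s 0 _)
  have ne_zero : netPremeasure T s 0 (cylinder []) ≠ 0 := by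
    rw [cylinder_nil]
    intro h0
    have eq_zero := netMeasure_eq_zero_of_netPremeasure_eq_zero hdet h0
    simp [netMeasure_eq_top_of_lt_sA hdet hT hs h] at eq_zero
  obtain ⟨μ, hμ, hμ_le⟩ := exists_isProbabilityMeasure_cylinder_le subadditive
    (netPremeasure_cylinder_ne_top T s) ne_zero
  refine ⟨μ, hμ, _, ENNReal.inv_ne_top.2 ne_zero, fun u => (hμ_le u).trans ?_⟩
  exact mul_le_mul_right (netPremeasure_cylinder_le T s u) _

end Frostman

section SublevelVolume

variable {d : ℕ} {S B : E d →L[ℝ] E d} {s r κ : ℝ}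

theorem IsRightSingularBasis.singularValues_mul_abs_repr_le {V W : Type*}
    [NormedAddCommGroup V] [InnerProductSpace ℝ V] [FiniteDimensional ℝ V]
    [NormedAddCommGroup W] [InnerProductSpace ℝ W] [FiniteDimensional ℝ W]
    {n : ℕ} {T : V →ₗ[ℝ] W} {e : OrthonormalBasis (Fin n) ℝ V} (he : IsRightSingularBasis T e)
    (x : V) (i : Fin n) : T.singularValues i * |e.repr x i| ≤ ‖T x‖ := by
  refine le_of_sq_le_sq ?_ (norm_nonneg (T x))
  rw [he.norm_sq_apply, mul_pow, sq_abs]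
  exact Finset.single_le_sum (f := fun i : Fin n => T.singularValues i ^ 2 * e.repr x i ^ 2)
    (fun i _ => by positivity) (Finset.mem_univ i)

theorem volume_forall_abs_repr_le (e : OrthonormalBasis (Fin d) ℝ (E d)) {b : Fin d → ℝ}
    (hb : ∀ i, 0 ≤ b i) :
    volume {x : E d | ∀ i, |e.repr x i| ≤ b i} = ENNReal.ofReal (∏ i, 2 * b i) := by
  have preimage_box : {x : E d | ∀ i, |e.repr x i| ≤ b i} =
      (fun x => WithLp.ofLp (e.repr x)) ⁻¹' (univ.pi fun i => Metric.closedBall 0 (b i)) := by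
    ext x
    simp
  have measurePreserving_coordinates :
      MeasurePreserving (fun x : E d => WithLp.ofLp (e.repr x)) volume volume :=
    (PiLp.volume_preserving_ofLp (Fin d)).comp e.measurePreserving_repr
  rw [preimage_box, measurePreserving_coordinates.measure_preimage (MeasurableSet.univ_pi fun i =>
    Metric.isClosed_closedBall.measurableSet).nullMeasurableSet, volume_pi_pi]
  simp only [Real.volume_closedBall]
  exact (ENNReal.ofReal_prod_of_nonneg fun i _ => mul_nonneg zero_le_two (hb i)).symm

theorem volume_norm_apply_le [NeZero d] (hS : S.det ≠ 0) {R : ℝ} (hs : 0 ≤ s) (hsd : s ≤ d)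
    (hR : 1 ≤ R) (hr : 0 ≤ r) :
    volume {x : E d | ‖x‖ ≤ R ∧ ‖S x‖ ≤ r} ≤ ENNReal.ofReal ((2 * R) ^ d * (r ^ s / svf s S)) := by
  obtain ⟨e, he⟩ := exists_isRightSingularBasis (S : E d →ₗ[ℝ] E d) finrank_euclideanSpace_fin
  have hR0 : 0 ≤ R := zero_le_one.trans hR
  have subset_box : {x : E d | ‖x‖ ≤ R ∧ ‖S x‖ ≤ r} ⊆
      {x | ∀ i : Fin d, |e.repr x i| ≤ R * min 1 (r / singVal S i)} := by
    rintro x ⟨hxR, hxr⟩ i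
    have abs_repr_le_norm : |e.repr x i| ≤ ‖x‖ := by
      simpa using PiLp.norm_apply_le (e.repr x) i
    have abs_repr_le_div : |e.repr x i| ≤ r / singVal S i := by
      rw [le_div_iff₀' (singVal_pos hS i.2)]
      exact (he.singularValues_mul_abs_repr_le x i).trans hxr
    rw [mul_min_of_nonneg _ _ hR0, mul_one]
    exact le_min (abs_repr_le_norm.trans hxR) (abs_repr_le_div.trans
      (le_mul_of_one_le_left (div_nonneg hr (singVal_nonneg S i)) hR))
  have side_nonneg (i : Fin d) : 0 ≤ R * min 1 (r / singVal S i) :=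
    mul_nonneg hR0 (le_min zero_le_one (div_nonneg hr (singVal_nonneg S i)))
  refine (measure_mono subset_box).trans ?_
  rw [volume_forall_abs_repr_le e side_nonneg]
  refine ENNReal.ofReal_le_ofReal ?_
  simp only [← mul_assoc]
  rw [Finset.prod_mul_distrib, Fin.prod_const,
    Fin.prod_univ_eq_prod_range (fun i => min 1 (r / singVal S i))]
  exact mul_le_mul_of_nonneg_left (prod_min_one_div_singVal_le S hs hsd hr) (by positivity)

theorem exists_mul_eq_one_of_forall_mul_norm_le {V : Type*} [NormedAddCommGroup V]
    [NormedSpace ℝ V] [FiniteDimensional ℝ V] {B : V →L[ℝ] V} (hκ : 0 < κ)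
    (hB : ∀ x, κ * ‖x‖ ≤ ‖B x‖) : ∃ B' : V →L[ℝ] V, B * B' = 1 ∧ ‖B'‖ ≤ κ⁻¹ := by
  have injective : Function.Injective (B : V →ₗ[ℝ] V) := by
    refine (injective_iff_map_eq_zero _).2 fun x hx => ?_
    have mul_norm_le : κ * ‖x‖ ≤ ‖(B : V →ₗ[ℝ] V) x‖ := hB x
    rw [hx, norm_zero] at mul_norm_le
    exact norm_le_zero_iff.1 (nonpos_of_mul_nonpos_right mul_norm_le hκ)
  let L := LinearEquiv.ofInjectiveEndo (B : V →ₗ[ℝ] V) injective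
  have apply_symm (x : V) : B (L.symm x) = x := L.apply_symm_apply x
  refine ⟨LinearMap.toContinuousLinearMap (L.symm : V →ₗ[ℝ] V), by ext x; exact apply_symm x,
    ContinuousLinearMap.opNorm_le_bound _ (inv_nonneg.2 hκ.le) fun x => ?_⟩
  rw [inv_mul_eq_div, le_div_iff₀' hκ]
  exact (hB (L.symm x)).trans_eq (by rw [apply_symm])

theorem det_ne_zero_of_forall_mul_norm_le (hκ : 0 < κ) (hB : ∀ x, κ * ‖x‖ ≤ ‖B x‖) :
    B.det ≠ 0 := by
  obtain ⟨B', hBB', -⟩ := exists_mul_eq_one_of_forall_mul_norm_le hκ hB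
  refine left_ne_zero_of_mul_eq_one (b := B'.det) ((LinearMap.det_comp _ _).symm.trans ?_)
  exact (congrArg ContinuousLinearMap.det hBB').trans (by simp [ContinuousLinearMap.det])

theorem svf_le_svf_mul_of_forall_mul_norm_le [NeZero d] (S : E d →L[ℝ] E d) (hs : 0 ≤ s)
    (hκ : 0 < κ) (hB : ∀ x, κ * ‖x‖ ≤ ‖B x‖) : svf s S ≤ svf s (S * B) * κ⁻¹ ^ s := by
  obtain ⟨B', hBB', hB'⟩ := exists_mul_eq_one_of_forall_mul_norm_le hκ hB
  have svf_inverse_le : svf s B' ≤ κ⁻¹ ^ s := by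
    refine (svf_le_svf_mul_norm_rpow B' le_rfl hs).trans ?_
    rw [svf_zero, one_mul, sub_zero]
    exact Real.rpow_le_rpow (norm_nonneg _) hB' hs
  calc svf s S = svf s (S * B * B') := by rw [mul_assoc, hBB', mul_one]
    _ ≤ svf s (S * B) * svf s B' := svf_mul_le _ _ _
    _ ≤ svf s (S * B) * κ⁻¹ ^ s := mul_le_mul_of_nonneg_left svf_inverse_le (svf_nonneg _ _)

theorem volume_norm_apply_add_le [NeZero d] (hS : S.det ≠ 0) {ρ : ℝ} (hs : 0 ≤ s) (hsd : s ≤ d)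
    (hκ : 0 < κ) (hB : ∀ x, κ * ‖x‖ ≤ ‖B x‖) (hρ : 1 ≤ ρ) (hr : 0 ≤ r) (z : E d) :
    volume {x : E d | ‖x‖ ≤ ρ ∧ ‖S (B x + z)‖ ≤ r} ≤
      ENNReal.ofReal ((4 * ρ) ^ d * 2 ^ s * κ⁻¹ ^ s * (r ^ s / svf s S)) := by
  obtain h | ⟨x₀, hx₀ρ, hx₀r⟩ := eq_empty_or_nonempty {x : E d | ‖x‖ ≤ ρ ∧ ‖S (B x + z)‖ ≤ r}
  · rw [h, measure_empty]
    exact bot_le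
  have det_ne_zero : (S * B).det ≠ 0 := (LinearMap.det_comp _ _).trans_ne
    (mul_ne_zero hS (det_ne_zero_of_forall_mul_norm_le hκ hB))
  have subset_translate : {x : E d | ‖x‖ ≤ ρ ∧ ‖S (B x + z)‖ ≤ r} ⊆
      (fun x => x - x₀) ⁻¹' {x | ‖x‖ ≤ 2 * ρ ∧ ‖(S * B) x‖ ≤ 2 * r} := by
    rintro x ⟨hxρ, hxr⟩
    have apply_sub : (S * B) (x - x₀) = S (B x + z) - S (B x₀ + z) := by
      rw [← map_sub, add_sub_add_right_eq_sub, ← map_sub]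
      rfl
    refine ⟨(norm_sub_le _ _).trans (by linarith), ?_⟩
    rw [apply_sub]
    exact (norm_sub_le _ _).trans (by linarith)
  have inv_svf_le : (svf s (S * B))⁻¹ ≤ κ⁻¹ ^ s * (svf s S)⁻¹ := by
    rw [← div_eq_mul_inv, le_div_iff₀ (svf_pos hS s), inv_mul_le_iff₀ (svf_pos det_ne_zero s)]
    exact svf_le_svf_mul_of_forall_mul_norm_le S hs hκ hB
  refine (measure_mono subset_translate).trans ?_
  simp only [sub_eq_add_neg]
  rw [measure_preimage_add_right]
  refine (volume_norm_apply_le det_ne_zero hs hsd (by linarith) (by linarith)).trans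
    (ENNReal.ofReal_le_ofReal ?_)
  calc (2 * (2 * ρ)) ^ d * ((2 * r) ^ s / svf s (S * B))
      = (4 * ρ) ^ d * (2 ^ s * r ^ s) * (svf s (S * B))⁻¹ := by
        rw [Real.mul_rpow zero_le_two hr]
        ring
    _ ≤ (4 * ρ) ^ d * (2 ^ s * r ^ s) * (κ⁻¹ ^ s * (svf s S)⁻¹) :=
        mul_le_mul_of_nonneg_left inv_svf_le (by positivity)
    _ = _ := by ring

theorem volume_le_mul_of_volume_update_le {V : Type*} [NormedAddCommGroup V] [MeasureSpace V]
    [OpensMeasurableSpace V] [SecondCountableTopology V] [SigmaFinite (volume : Measure V)] {m : ℕ}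
    (i : Fin (m + 1)) {A : Set (Fin (m + 1) → V)} (hA : MeasurableSet A) {ρ : ℝ} (hρ : 0 ≤ ρ)
    (hAρ : ∀ a ∈ A, ‖a‖ ≤ ρ) {c : ℝ≥0∞}
    (h : ∀ a, volume {x : V | Function.update a i x ∈ A} ≤ c) :
    volume A ≤ c * volume (Metric.closedBall (0 : Fin m → V) ρ) := by
  have measurePreserving_insertNth :=
    (volume_preserving_piFinSuccAbove (fun _ : Fin (m + 1) => V) i).symm
  rw [← measurePreserving_insertNth.measure_preimage hA.nullMeasurableSet]
  refine (Measure.prod_apply_symm (measurePreserving_insertNth.measurable hA)).trans_le ?_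
  rw [← setLIntegral_const, ← lintegral_indicator Metric.isClosed_closedBall.measurableSet]
  refine lintegral_mono fun y => ?_
  have insertNth_eq_update (x : V) : (MeasurableEquiv.piFinSuccAbove (fun _ => V) i).symm (x, y) =
      Function.update (i.insertNth (0 : V) y : Fin (m + 1) → V) i x := by
    rw [MeasurableEquiv.piFinSuccAbove_symm_apply, Fin.update_insertNth]
    rfl
  have section_eq : (fun x => (x, y)) ⁻¹'
      ((MeasurableEquiv.piFinSuccAbove (fun _ => V) i).symm ⁻¹' A) =
        {x | Function.update (i.insertNth (0 : V) y : Fin (m + 1) → V) i x ∈ A} := by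
    ext x
    rw [mem_preimage, mem_preimage, insertNth_eq_update]
    rfl
  rw [section_eq]
  by_cases hy : y ∈ Metric.closedBall (0 : Fin m → V) ρ
  · rw [indicator_of_mem hy]
    exact h _
  · rw [indicator_of_notMem hy, nonpos_iff_eq_zero]
    convert measure_empty (μ := (volume : Measure V))
    refine eq_empty_of_forall_notMem fun x hx =>
      hy (mem_closedBall_zero_iff.2 ((pi_norm_le_iff_of_nonneg hρ).2 fun j => ?_))
    simpa [Fin.succAbove_ne] using (norm_le_pi_norm _ (i.succAbove j)).trans (hAρ _ hx)

end SublevelVolume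

section Transversality

variable {d M : ℕ} {T : Fin M → (E d →L[ℝ] E d)}

/-- The coefficient of the translation `a_i` in the point `π_a(v)`, a linear map. -/
noncomputable def codingCoeff (T : Fin M → (E d →L[ℝ] E d)) (v : ℕ → Fin M) (i : Fin M) :
    E d →L[ℝ] E d :=
  ∑' k, if v k = i then wordMap T (initWord v k) else 0

theorem norm_codingCoeff_term_le (T : Fin M → (E d →L[ℝ] E d)) (v : ℕ → Fin M) (i : Fin M)
    (k : ℕ) : ‖if v k = i then wordMap T (initWord v k) else 0‖ ≤ ‖T‖ ^ k := by
  split_ifs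
  · simpa using norm_wordMap_le T (initWord v k)
  · simp

theorem summable_codingCoeff (hT : ‖T‖ < 1) (v : ℕ → Fin M) (i : Fin M) :
    Summable fun k => if v k = i then wordMap T (initWord v k) else 0 :=
  .of_norm_bounded (summable_geometric_of_lt_one (norm_nonneg T) hT)
    (norm_codingCoeff_term_le T v i)

theorem norm_codingCoeff_le_inv (hT : ‖T‖ < 1) (v : ℕ → Fin M) (i : Fin M) :
    ‖codingCoeff T v i‖ ≤ (1 - ‖T‖)⁻¹ :=
  tsum_of_norm_bounded (hasSum_geometric_of_lt_one (norm_nonneg T) hT)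
    (norm_codingCoeff_term_le T v i)

theorem codingCoeff_eq (hT : ‖T‖ < 1) (v : ℕ → Fin M) (i : Fin M) :
    codingCoeff T v i =
      T (v 0) * codingCoeff T (fun n => v (n + 1)) i + if v 0 = i then 1 else 0 := by
  rw [codingCoeff, (summable_codingCoeff hT v i).tsum_eq_zero_add, codingCoeff,
    ← (summable_codingCoeff hT _ i).tsum_mul_left, add_comm]
  simp [initWord_succ]

theorem coding_eq_sum_codingCoeff (hT : ‖T‖ < 1) (a : Fin M → E d) (v : ℕ → Fin M) :
    coding T a v = ∑ i, codingCoeff T v i (a i) := by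
  have hasSum_apply (i : Fin M) :
      HasSum (fun k => (if v k = i then wordMap T (initWord v k) else 0) (a i))
        (codingCoeff T v i (a i)) :=
    (ContinuousLinearMap.apply ℝ (E d) (a i)).hasSum (summable_codingCoeff hT v i).hasSum
  refine HasSum.tsum_eq ?_
  convert hasSum_sum fun i (_ : i ∈ Finset.univ) => hasSum_apply i using 2 with k
  rw [Fintype.sum_eq_single (v k) fun i hi => by rw [if_neg hi.symm, zero_apply], if_pos rfl]

theorem coding_update (hT : ‖T‖ < 1) (v : ℕ → Fin M) (i : Fin M) (a : Fin M → E d) (x : E d) :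
    coding T (Function.update a i x) v =
      codingCoeff T v i x + coding T (Function.update a i 0) v := by
  simp only [coding_eq_sum_codingCoeff hT, ← Finset.add_sum_erase _ _ (Finset.mem_univ i),
    Function.update_self, map_zero, zero_add]
  congr 1
  refine Finset.sum_congr rfl fun j hj => ?_
  rw [Function.update_of_ne (Finset.ne_of_mem_erase hj),
    Function.update_of_ne (Finset.ne_of_mem_erase hj)]

theorem coding_update_sub_coding_update (hT : ‖T‖ < 1) (v w : ℕ → Fin M) (i : Fin M)
    (a : Fin M → E d) (x : E d) :
    coding T (Function.update a i x) v - coding T (Function.update a i x) w =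
      (codingCoeff T v i - codingCoeff T w i) x +
        (coding T (Function.update a i 0) v - coding T (Function.update a i 0) w) := by
  rw [coding_update hT v, coding_update hT w, sub_apply]
  abel

theorem norm_codingCoeff_le (hT : ‖T‖ < 1) (v : ℕ → Fin M) (i : Fin M) :
    ‖codingCoeff T v i‖ ≤
      ‖T (v 0)‖ * ‖codingCoeff T (fun n => v (n + 1)) i‖ + if v 0 = i then 1 else 0 := by
  rw [codingCoeff_eq hT v i]
  refine (norm_add_le _ _).trans (add_le_add (norm_mul_le _ _) ?_)
  split_ifs
  · exact ContinuousLinearMap.norm_id_le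
  · simp

theorem sum_mul_norm_codingCoeff_le_one (hT : ‖T‖ < 1) (v : ℕ → Fin M) :
    ∑ i, (1 - ‖T i‖) * ‖codingCoeff T v i‖ ≤ 1 := by
  let f (v : ℕ → Fin M) : ℝ := ∑ i, (1 - ‖T i‖) * ‖codingCoeff T v i‖
  have weight_nonneg (i : Fin M) : 0 ≤ 1 - ‖T i‖ := by linarith [norm_le_pi_norm T i]
  have recursion (v : ℕ → Fin M) :
      f v - 1 ≤ ‖T (v 0)‖ * (f (fun n => v (n + 1)) - 1) := by
    suffices f v ≤ ‖T (v 0)‖ * f (fun n => v (n + 1)) + (1 - ‖T (v 0)‖) by linarith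
    calc f v ≤ ∑ i, (1 - ‖T i‖) * (‖T (v 0)‖ * ‖codingCoeff T (fun n => v (n + 1)) i‖ +
            if v 0 = i then 1 else 0) :=
          Finset.sum_le_sum fun i _ =>
            mul_le_mul_of_nonneg_left (norm_codingCoeff_le hT v i) (weight_nonneg i)
      _ = _ := by
          simp only [f, mul_add, Finset.sum_add_distrib, Finset.mul_sum, mul_ite, mul_one,
            mul_zero, Finset.sum_ite_eq, Finset.mem_univ, if_true, mul_left_comm]
  obtain ⟨B, hB0, hB⟩ : ∃ B, 0 ≤ B ∧ ∀ v, f v - 1 ≤ B := by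
    refine ⟨∑ i, (1 - ‖T i‖) * (1 - ‖T‖)⁻¹, Finset.sum_nonneg fun i _ => mul_nonneg
      (weight_nonneg i) (inv_nonneg.2 (by linarith)), fun v => (sub_le_self _ zero_le_one).trans ?_⟩
    exact Finset.sum_le_sum fun i _ =>
      mul_le_mul_of_nonneg_left (norm_codingCoeff_le_inv hT v i) (weight_nonneg i)
  have iterated (n : ℕ) : ∀ v, f v - 1 ≤ ‖T‖ ^ n * B := by
    induction n with
    | zero => simpa using hB
    | succ n ih =>
      intro v
      calc f v - 1 ≤ ‖T (v 0)‖ * (‖T‖ ^ n * B) :=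
            (recursion v).trans (mul_le_mul_of_nonneg_left (ih _) (norm_nonneg _))
        _ ≤ ‖T‖ ^ (n + 1) * B := by
            rw [pow_succ', mul_assoc]
            gcongr
            exact norm_le_pi_norm T _
  have tendsto_bound : Tendsto (fun n => ‖T‖ ^ n * B) atTop (𝓝 0) := by
    simpa using (tendsto_pow_atTop_nhds_zero_of_lt_one (norm_nonneg T) hT).mul_const B
  exact sub_nonpos.1 (ge_of_tendsto' tendsto_bound fun n => iterated n v)

theorem add_mul_norm_codingCoeff_le_one (hT : ‖T‖ < 1) (v : ℕ → Fin M) {i j : Fin M}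
    (hij : i ≠ j) :
    (1 - ‖T i‖) * ‖codingCoeff T v i‖ + (1 - ‖T j‖) * ‖codingCoeff T v j‖ ≤ 1 := by
  refine le_trans ?_ (sum_mul_norm_codingCoeff_le_one hT v)
  rw [← Finset.sum_pair hij (f := fun i => (1 - ‖T i‖) * ‖codingCoeff T v i‖)]
  refine Finset.sum_le_univ_sum_of_nonneg fun k => mul_nonneg ?_ (norm_nonneg _)
  linarith [norm_le_pi_norm T k]

theorem norm_sub_mul_norm_le_norm_add_apply {V W : Type*} [NormedAddCommGroup V] [NormedSpace ℝ V]
    [NormedAddCommGroup W] [NormedSpace ℝ W] (A P : V →L[ℝ] W) {q : ℝ} (hP : ‖P‖ ≤ q) (x : V) :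
    ‖A x‖ - q * ‖x‖ ≤ ‖(A + P) x‖ := by
  rw [add_apply]
  linarith [norm_sub_le_norm_add (A x) (P x), P.le_of_opNorm_le hP x]

theorem norm_mul_codingCoeff_add_le_or (hT : ‖T‖ < 1) {c : ℝ} (hc2 : c < 2) {i j : Fin M}
    (hij : i ≠ j) (hc : ‖T i‖ + ‖T j‖ ≤ c) (v w : ℕ → Fin M) :
    ‖T i‖ * ‖codingCoeff T v i‖ + ‖T j‖ * ‖codingCoeff T w i‖ ≤ c / (2 - c) ∨
      ‖T i‖ * ‖codingCoeff T v j‖ + ‖T j‖ * ‖codingCoeff T w j‖ ≤ c / (2 - c) := by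
  by_contra! large
  have hc_nonneg : 0 ≤ c := (add_nonneg (norm_nonneg (T i)) (norm_nonneg (T j))).trans hc
  have hi : 0 < 1 - ‖T i‖ := by linarith [norm_le_pi_norm T i]
  have hj : 0 < 1 - ‖T j‖ := by linarith [norm_le_pi_norm T j]
  have weighted_sum_le :
      (1 - ‖T i‖) * (‖T i‖ * ‖codingCoeff T v i‖ + ‖T j‖ * ‖codingCoeff T w i‖) +
        (1 - ‖T j‖) * (‖T i‖ * ‖codingCoeff T v j‖ + ‖T j‖ * ‖codingCoeff T w j‖) ≤ c := by
    linarith [mul_le_mul_of_nonneg_left (add_mul_norm_codingCoeff_le_one hT v hij)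
        (norm_nonneg (T i)),
      mul_le_mul_of_nonneg_left (add_mul_norm_codingCoeff_le_one hT w hij) (norm_nonneg (T j))]
  have weighted_const_ge :
      c ≤ (1 - ‖T i‖) * (c / (2 - c)) + (1 - ‖T j‖) * (c / (2 - c)) := by
    rw [← add_mul, mul_div_assoc', le_div_iff₀' (by linarith)]
    exact mul_le_mul_of_nonneg_right (by linarith) hc_nonneg
  linarith [mul_lt_mul_of_pos_left large.1 hi, mul_lt_mul_of_pos_left large.2 hj]

/-- If `v` and `w` begin with different letters `i` and `j`, the coefficients of `a_i` and `a_j`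
in `π_a(v) - π_a(w)` are perturbations of `1` and `-1`, and one of the two perturbations is
small. -/
theorem exists_mul_norm_le_norm_codingCoeff_sub (hT : ‖T‖ < 1) {c : ℝ} (hc2 : c < 2)
    (hc : ∀ i j, i ≠ j → ‖T i‖ + ‖T j‖ ≤ c) {v w : ℕ → Fin M} (hvw : v 0 ≠ w 0) :
    ∃ i, ∀ x, (1 - c / (2 - c)) * ‖x‖ ≤ ‖(codingCoeff T v i - codingCoeff T w i) x‖ := by
  let P (k : Fin M) : E d →L[ℝ] E d := T (v 0) * codingCoeff T (fun n => v (n + 1)) k -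
    T (w 0) * codingCoeff T (fun n => w (n + 1)) k
  have coeff_v : codingCoeff T v (v 0) - codingCoeff T w (v 0) = 1 + P (v 0) := by
    rw [codingCoeff_eq hT v, codingCoeff_eq hT w, if_pos rfl, if_neg hvw.symm]
    simp only [P]
    abel
  have coeff_w : codingCoeff T v (w 0) - codingCoeff T w (w 0) = -1 + P (w 0) := by
    rw [codingCoeff_eq hT v, codingCoeff_eq hT w, if_pos rfl, if_neg hvw]
    simp only [P]
    abel
  have norm_P_le (k : Fin M) :
      ‖P k‖ ≤ ‖T (v 0)‖ * ‖codingCoeff T (fun n => v (n + 1)) k‖ +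
        ‖T (w 0)‖ * ‖codingCoeff T (fun n => w (n + 1)) k‖ :=
    (norm_sub_le _ _).trans (add_le_add (norm_mul_le _ _) (norm_mul_le _ _))
  obtain small | small := norm_mul_codingCoeff_add_le_or hT hc2 hvw (hc _ _ hvw)
    (fun n => v (n + 1)) fun n => w (n + 1)
  · refine ⟨v 0, fun x => ?_⟩
    rw [coeff_v, sub_mul, one_mul]
    exact norm_sub_mul_norm_le_norm_add_apply 1 _ ((norm_P_le _).trans small) x
  · refine ⟨w 0, fun x => ?_⟩
    rw [coeff_w, sub_mul, one_mul]
    convert norm_sub_mul_norm_le_norm_add_apply (-1) _ ((norm_P_le _).trans small) x using 2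
    exact (norm_neg x).symm

theorem isClosed_norm_coding_sub_le (hT : ‖T‖ < 1) (v w : ℕ → Fin M) (ρ r : ℝ) :
    IsClosed {a : Fin M → E d | ‖a‖ ≤ ρ ∧ ‖coding T a v - coding T a w‖ ≤ r} := by
  have continuous_left (v : ℕ → Fin M) : Continuous fun a : Fin M → E d => coding T a v :=
    (continuous_coding hT).comp (continuous_id.prodMk continuous_const)
  exact (isClosed_le continuous_norm continuous_const).inter
    (isClosed_le ((continuous_left v).sub (continuous_left w)).norm continuous_const)

theorem exists_volume_norm_coding_sub_le [NeZero d] (hdet : ∀ j, (T j).det ≠ 0) (hT : ‖T‖ < 1)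
    {c : ℝ} (hc1 : c < 1) (hc : ∀ i j, i ≠ j → ‖T i‖ + ‖T j‖ ≤ c)
    {s ρ : ℝ} (hs : 0 ≤ s) (hsd : s ≤ d) (hρ : 1 ≤ ρ) :
    ∃ C : ℝ≥0∞, C ≠ ∞ ∧ ∀ (v w : ℕ → Fin M) (n : ℕ), (∀ i < n, v i = w i) → v n ≠ w n →
      ∀ r : ℝ, 0 ≤ r → volume {a : Fin M → E d | ‖a‖ ≤ ρ ∧ ‖coding T a v - coding T a w‖ ≤ r} ≤
        C * ENNReal.ofReal (r ^ s) / ENNReal.ofReal (svf s (wordMap T (initWord v n))) := by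
  obtain _ | m := M
  · exact ⟨0, ENNReal.zero_ne_top, fun v => (v 0).elim0⟩
  set κ := 1 - c / (2 - c)
  have hκ : 0 < κ := by
    rw [sub_pos, div_lt_one (by linarith)]
    linarith
  refine ⟨ENNReal.ofReal ((4 * ρ) ^ d * 2 ^ s * κ⁻¹ ^ s) *
    volume (Metric.closedBall (0 : Fin m → E d) ρ),
    ENNReal.mul_ne_top ENNReal.ofReal_ne_top measure_closedBall_lt_top.ne, ?_⟩
  intro v w n hvw hne r hr
  have det_ne_zero := det_wordMap_ne_zero hdet (initWord v n)
  obtain ⟨i, hi⟩ := exists_mul_norm_le_norm_codingCoeff_sub hT (by linarith) hc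
    (v := fun k => v (k + n)) (w := fun k => w (k + n)) (by simpa using hne)
  have volume_section_le (a : Fin (m + 1) → E d) :
      volume {x : E d | Function.update a i x ∈
        {a | ‖a‖ ≤ ρ ∧ ‖coding T a v - coding T a w‖ ≤ r}} ≤
      ENNReal.ofReal ((4 * ρ) ^ d * 2 ^ s * κ⁻¹ ^ s *
        (r ^ s / svf s (wordMap T (initWord v n)))) := by
    refine le_trans (measure_mono ?_)
      (volume_norm_apply_add_le det_ne_zero hs hsd hκ hi hρ hr
        (coding T (Function.update a i 0) (fun k => v (k + n)) -
          coding T (Function.update a i 0) fun k => w (k + n)))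
    rintro x ⟨hxρ, hxr⟩
    refine ⟨by simpa using (norm_le_pi_norm _ i).trans hxρ, ?_⟩
    rwa [coding_sub_coding hT _ n hvw, coding_update_sub_coding_update hT] at hxr
  refine (volume_le_mul_of_volume_update_le i (isClosed_norm_coding_sub_le hT v w ρ r).measurableSet
    (by linarith) (fun a ha => ha.1) volume_section_le).trans_eq ?_
  rw [ENNReal.ofReal_mul (by positivity), ENNReal.ofReal_div_of_pos (svf_pos det_ne_zero s)]
  simp only [div_eq_mul_inv]
  ring

end Transversality

section MassDistribution

variable {X : Type*} [MetricSpace X] [MeasurableSpace X] {ν : Measure X}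
  {t : ℝ} {C : ℝ≥0∞}

theorem measure_closedBall_le_of_forall_pow {x : X} (ht : 0 ≤ t)
    (h : ∀ n : ℕ, ν (Metric.closedBall x ((1 / 2 : ℝ) ^ n)) ≤
      C * ENNReal.ofReal (((1 / 2 : ℝ) ^ n) ^ t)) (hC : C ≠ ∞) {r : ℝ} (hr : r ∈ Icc (0 : ℝ) 1) :
    ν (Metric.closedBall x r) ≤ C * ENNReal.ofReal (2 ^ t) * ENNReal.ofReal (r ^ t) := by
  rw [mul_assoc, ← ENNReal.ofReal_mul (by positivity), ← Real.mul_rpow zero_le_two hr.1]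
  obtain rfl | hr0 := hr.1.eq_or_lt
  · have tendsto_rpow : Tendsto (fun n : ℕ => ((1 / 2 : ℝ) ^ n) ^ t) atTop (𝓝 (0 ^ t)) :=
      (tendsto_pow_atTop_nhds_zero_of_lt_one (by norm_num) (by norm_num)).rpow_const (Or.inr ht)
    rw [mul_zero]
    refine ge_of_tendsto' (ENNReal.Tendsto.const_mul (ENNReal.tendsto_ofReal tendsto_rpow)
      (Or.inr hC)) fun n => le_trans (measure_mono ?_) (h n)
    exact Metric.closedBall_subset_closedBall (by positivity)
  · obtain ⟨n, lt_r, r_le⟩ := exists_nat_pow_near_of_lt_one hr0 hr.2 (y := (1 / 2 : ℝ))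
      (by norm_num) (by norm_num)
    refine (measure_mono (Metric.closedBall_subset_closedBall r_le)).trans ((h n).trans ?_)
    gcongr
    rw [pow_succ] at lt_r
    linarith

variable [BorelSpace X]

theorem le_dimH_of_measure_closedBall_le {A : Set X} (hA : MeasurableSet A) (hνA : ν A ≠ 0)
    (ht : 0 ≤ t) (hC : C ≠ ∞)
    (h : ∀ x ∈ A, ∀ r ∈ Icc (0 : ℝ) 1, ν (Metric.closedBall x r) ≤ C * ENNReal.ofReal (r ^ t)) :
    ENNReal.ofReal t ≤ dimH A := by
  have smul_le_hausdorffMeasure : C⁻¹ • ν.restrict A ≤ μH[t] := by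
    refine Measure.le_hausdorffMeasure t _ 1 one_pos fun U hU => ?_
    rw [Measure.smul_apply, smul_eq_mul, Measure.restrict_apply' hA, mul_comm, ← div_eq_mul_inv]
    obtain hempty | ⟨x, hxU, hxA⟩ := (U ∩ A).eq_empty_or_nonempty
    · simp [hempty]
    have ediam_ne_top : Metric.ediam U ≠ ∞ := (hU.trans_lt ENNReal.one_lt_top).ne
    have toReal_le_one : (Metric.ediam U).toReal ≤ 1 := by
      simpa using ENNReal.toReal_mono ENNReal.one_ne_top hU
    have subset_closedBall : U ⊆ Metric.closedBall x (Metric.ediam U).toReal := fun y hy => by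
      rw [Metric.mem_closedBall, dist_edist]
      exact ENNReal.toReal_mono ediam_ne_top (Metric.edist_le_ediam_of_mem hy hxU)
    refine ENNReal.div_le_of_le_mul ?_
    calc ν (U ∩ A) ≤ ν (Metric.closedBall x (Metric.ediam U).toReal) :=
          measure_mono (inter_subset_left.trans subset_closedBall)
      _ ≤ C * ENNReal.ofReal ((Metric.ediam U).toReal ^ t) :=
          h x hxA _ ⟨ENNReal.toReal_nonneg, toReal_le_one⟩
      _ = Metric.ediam U ^ t * C := by
          rw [← ENNReal.ofReal_rpow_of_nonneg ENNReal.toReal_nonneg ht,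
            ENNReal.ofReal_toReal ediam_ne_top, mul_comm]
  refine le_dimH_of_hausdorffMeasure_ne_zero fun h0 => hνA ?_
  rw [Real.coe_toNNReal _ ht] at h0
  have smul_eq_zero := le_antisymm ((smul_le_hausdorffMeasure A).trans_eq h0) zero_le
  rw [Measure.smul_apply, smul_eq_mul, Measure.restrict_apply_self] at smul_eq_zero
  exact (mul_eq_zero.1 smul_eq_zero).resolve_left (ENNReal.inv_ne_zero.2 hC)

variable [SecondCountableTopology X]

theorem measurableSet_dist_le (r : ℝ) : MeasurableSet {p : X × X | dist p.2 p.1 ≤ r} :=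
  (isClosed_le (continuous_snd.dist continuous_fst) continuous_const).measurableSet

theorem measurable_measure_closedBall (ν : Measure X) [SFinite ν] (r : ℝ) :
    Measurable fun x => ν (Metric.closedBall x r) :=
  measurable_measure_prodMk_left (measurableSet_dist_le r)

theorem le_dimH_of_tsum_lintegral_closedBall_ne_top [SFinite ν] {F : Set X}
    (hF : MeasurableSet F) (hνF : ν F ≠ 0) (ht : 0 ≤ t)
    (h : ∑' n : ℕ, (∫⁻ x, ν (Metric.closedBall x ((1 / 2 : ℝ) ^ n)) ∂ν) /
      ENNReal.ofReal (((1 / 2 : ℝ) ^ n) ^ t) ≠ ∞) :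
    ENNReal.ofReal t ≤ dimH F := by
  let weight : ℕ → ℝ≥0∞ := fun n => ENNReal.ofReal (((1 / 2 : ℝ) ^ n) ^ t)
  have weight_ne_zero (n : ℕ) : weight n ≠ 0 := by
    rw [← pos_iff_ne_zero, ENNReal.ofReal_pos]
    positivity
  let potential : X → ℝ≥0∞ := fun x =>
    ∑' n : ℕ, ν (Metric.closedBall x ((1 / 2 : ℝ) ^ n)) / weight n
  have measurable_term (n : ℕ) :
      Measurable fun x => ν (Metric.closedBall x ((1 / 2 : ℝ) ^ n)) / weight n :=
    (measurable_measure_closedBall ν _).div_const _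
  have measurable_potential : Measurable potential := Measurable.tsum measurable_term
  have ae_potential_lt_top : ∀ᵐ x ∂ν, potential x < ∞ := by
    refine ae_lt_top measurable_potential ?_
    rw [lintegral_tsum fun n => (measurable_term n).aemeasurable]
    simp only [div_eq_mul_inv, lintegral_mul_const _ (measurable_measure_closedBall ν _)] at h ⊢
    exact h
  obtain ⟨N, hN⟩ : ∃ N : ℕ, ν ({x | potential x ≤ N} ∩ F) ≠ 0 := by
    by_contra! forall_null
    refine hνF (measure_mono_null (fun x hx => ?_)
      (measure_union_null ae_potential_lt_top (measure_iUnion_null forall_null)))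
    by_cases hfin : potential x < ∞
    · obtain ⟨n, hn⟩ := ENNReal.exists_nat_gt hfin.ne
      exact Or.inr (mem_iUnion.2 ⟨n, hn.le, hx⟩)
    · exact Or.inl hfin
  refine le_trans ?_ (dimH_mono (s := {x | potential x ≤ N} ∩ F) inter_subset_right)
  refine le_dimH_of_measure_closedBall_le ((measurableSet_le measurable_potential
    measurable_const).inter hF) hN ht
    (ENNReal.mul_ne_top (ENNReal.natCast_ne_top N) ENNReal.ofReal_ne_top) fun x hx r hr =>
    measure_closedBall_le_of_forall_pow ht (fun n => ?_) (ENNReal.natCast_ne_top N) hr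
  exact (ENNReal.div_le_iff (weight_ne_zero n) ENNReal.ofReal_ne_top).1
    ((ENNReal.le_tsum n).trans hx.1)

theorem lintegral_setLIntegral_closedBall (κ ν : Measure X) [SFinite κ] [SFinite ν] (r : ℝ)
    {k : X → ℝ≥0∞} (hk : Measurable k) :
    ∫⁻ x, ∫⁻ y in Metric.closedBall x r, k y ∂ν ∂κ =
      ∫⁻ y, κ (Metric.closedBall y r) * k y ∂ν := by
  have measurable_indicator : Measurable (Function.uncurry fun x y =>
      (Metric.closedBall x r).indicator k y) :=
    (hk.comp measurable_snd).indicator (measurableSet_dist_le r)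
  simp only [← lintegral_indicator Metric.isClosed_closedBall.measurableSet]
  rw [lintegral_lintegral_swap measurable_indicator.aemeasurable]
  refine lintegral_congr fun y => ?_
  have indicator_swap (x : X) : (Metric.closedBall x r).indicator k y =
      (Metric.closedBall y r).indicator (fun _ => k y) x := by
    simp only [indicator, Metric.mem_closedBall, dist_comm y x]
  simp only [indicator_swap]
  rw [lintegral_indicator Metric.isClosed_closedBall.measurableSet, setLIntegral_const, mul_comm]

end MassDistribution

section NeighbourhoodVolume

theorem sq_lintegral_le {Y : Type*} [MeasurableSpace Y] (μ : Measure Y) {g : Y → ℝ≥0∞}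
    (hg : AEMeasurable g μ) : (∫⁻ y, g y ∂μ) ^ 2 ≤ μ univ * ∫⁻ y, g y ^ 2 ∂μ := by
  have cauchy_schwarz := ENNReal.lintegral_mul_le_Lp_mul_Lq μ Real.HolderConjugate.two_two
    (aemeasurable_const (b := (1 : ℝ≥0∞))) hg
  simp only [Pi.mul_apply, one_mul, ENNReal.rpow_two, one_pow, lintegral_one,
    ← ENNReal.mul_rpow_of_nonneg _ _ (show (0 : ℝ) ≤ 1 / 2 by norm_num)] at cauchy_schwarz
  refine (pow_le_pow_left' cauchy_schwarz 2).trans_eq ?_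
  rw [← ENNReal.rpow_natCast, ← ENNReal.rpow_mul]
  norm_num

variable {V : Type*} [NormedAddCommGroup V] [NormedSpace ℝ V] [FiniteDimensional ℝ V]
  [MeasurableSpace V] [BorelSpace V] (κ : Measure V) [κ.IsAddHaarMeasure]
  {ν : Measure V} {F : Set V}

theorem lintegral_sq_measure_closedBall_le (ν : Measure V) [SFinite ν] (r : ℝ) :
    ∫⁻ x, ν (Metric.closedBall x r) ^ 2 ∂κ ≤
      κ (Metric.closedBall 0 r) * ∫⁻ y, ν (Metric.closedBall y (2 * r)) ∂ν := by
  have measurable_double := measurable_measure_closedBall ν (2 * r)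
  calc ∫⁻ x, ν (Metric.closedBall x r) ^ 2 ∂κ
      = ∫⁻ x, ∫⁻ _ in Metric.closedBall x r, ν (Metric.closedBall x r) ∂ν ∂κ := by
        simp only [setLIntegral_const, sq]
    _ ≤ ∫⁻ x, ∫⁻ y in Metric.closedBall x r, ν (Metric.closedBall y (2 * r)) ∂ν ∂κ := by
        refine lintegral_mono fun x => setLIntegral_mono measurable_double fun y hy =>
          measure_mono (Metric.closedBall_subset_closedBall' ?_)
        rw [dist_comm]
        linarith [Metric.mem_closedBall.1 hy]
    _ = κ (Metric.closedBall 0 r) * ∫⁻ y, ν (Metric.closedBall y (2 * r)) ∂ν := by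
        rw [lintegral_setLIntegral_closedBall κ ν r measurable_double]
        simp only [Measure.addHaar_closedBall_center]
        exact lintegral_const_mul _ measurable_double

theorem measure_closedBall_le_cthickening_mul_lintegral [IsProbabilityMeasure ν]
    (hνF : ν Fᶜ = 0) {r : ℝ} (hr : 0 < r) :
    κ (Metric.closedBall 0 r) ≤
      κ (Metric.cthickening r F) * ∫⁻ y, ν (Metric.closedBall y (2 * r)) ∂ν := by
  have lintegral_eq : ∫⁻ x, ν (Metric.closedBall x r) ∂κ = κ (Metric.closedBall 0 r) := by
    have fubini := lintegral_setLIntegral_closedBall κ ν r (k := fun _ => 1) measurable_const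
    simpa only [lintegral_one, Measure.restrict_apply_univ, mul_one,
      Measure.addHaar_closedBall_center, lintegral_const, measure_univ] using fubini
  have support_subset : Function.support (fun x => ν (Metric.closedBall x r)) ⊆
      Metric.cthickening r F := fun x hx => by
    obtain ⟨y, hy, hyF⟩ : (Metric.closedBall x r ∩ F).Nonempty := by
      by_contra! hempty
      exact hx (measure_mono_null (disjoint_iff_inter_eq_empty.2 hempty).subset_compl_right hνF)
    exact Metric.mem_cthickening_of_dist_le x y r F hyF (Metric.mem_closedBall'.1 hy)
  refine (ENNReal.mul_le_mul_iff_right (Metric.measure_closedBall_pos κ 0 hr).ne'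
    measure_closedBall_lt_top.ne).1 ?_
  calc κ (Metric.closedBall 0 r) * κ (Metric.closedBall 0 r)
      = (∫⁻ x in Metric.cthickening r F, ν (Metric.closedBall x r) ∂κ) ^ 2 := by
        rw [setLIntegral_eq_of_support_subset support_subset, lintegral_eq, sq]
    _ ≤ κ (Metric.cthickening r F) *
          ∫⁻ x in Metric.cthickening r F, ν (Metric.closedBall x r) ^ 2 ∂κ := by
        refine (sq_lintegral_le _ (measurable_measure_closedBall ν r).aemeasurable).trans_eq ?_
        rw [Measure.restrict_apply_univ]
    _ ≤ κ (Metric.cthickening r F) *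
          (κ (Metric.closedBall 0 r) * ∫⁻ y, ν (Metric.closedBall y (2 * r)) ∂ν) := by
        gcongr
        exact (setLIntegral_le_lintegral _ _).trans (lintegral_sq_measure_closedBall_le κ ν r)
    _ = _ := mul_left_comm _ _ _

theorem exists_pos_le_measure_cthickening_mul_lintegral :
    ∃ c : ℝ≥0∞, 0 < c ∧ ∀ (ν : Measure V) [IsProbabilityMeasure ν] (F : Set V), ν Fᶜ = 0 →
      ∀ r : ℝ, 0 < r → c ≤ κ (Metric.cthickening (r / 2) F) *
        ((∫⁻ x, ν (Metric.closedBall x r) ∂ν) / ENNReal.ofReal (r ^ Module.finrank ℝ V)) := by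
  refine ⟨κ (Metric.closedBall 0 (1 / 2)), Metric.measure_closedBall_pos κ 0 one_half_pos,
    fun ν _ F hνF r hr => ?_⟩
  have bound := measure_closedBall_le_cthickening_mul_lintegral κ hνF (half_pos hr)
  have scaling : κ (Metric.closedBall 0 (r / 2)) =
      κ (Metric.closedBall 0 (1 / 2)) * ENNReal.ofReal (r ^ Module.finrank ℝ V) := by
    rw [← mul_one_div, Measure.addHaar_closedBall_mul_of_pos κ _ hr, mul_comm]
  rw [mul_div_cancel₀ _ two_ne_zero, scaling] at bound
  rw [← mul_div_assoc]
  refine (ENNReal.le_div_iff_mul_le (Or.inl ?_) (Or.inl ENNReal.ofReal_ne_top)).2 bound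
  rw [← pos_iff_ne_zero, ENNReal.ofReal_pos]
  positivity

theorem measure_pos_of_liminf_lintegral_closedBall_lt_top [IsProbabilityMeasure ν]
    (hF : IsCompact F) (hνF : ν Fᶜ = 0)
    (h : liminf (fun n : ℕ => (∫⁻ x, ν (Metric.closedBall x ((1 / 2 : ℝ) ^ n)) ∂ν) /
      ENNReal.ofReal (((1 / 2 : ℝ) ^ n) ^ Module.finrank ℝ V)) atTop < ∞) :
    0 < κ F := by
  refine pos_iff_ne_zero.2 fun κ_eq_zero => ?_
  obtain ⟨K, hK, K_lt_top⟩ := exists_between h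
  obtain ⟨c, c_pos, le_mul⟩ := exists_pos_le_measure_cthickening_mul_lintegral κ
  have radius_tendsto : Tendsto (fun n : ℕ => (1 / 2 : ℝ) ^ n / 2) atTop (𝓝 0) := by
    simpa using (tendsto_pow_atTop_nhds_zero_of_lt_one (r := (1 / 2 : ℝ)) (by norm_num)
      (by norm_num)).div_const 2
  have tendsto_mul : Tendsto (fun n : ℕ => κ (Metric.cthickening ((1 / 2 : ℝ) ^ n / 2) F) * K)
      atTop (𝓝 0) := by
    have tendsto_measure := (tendsto_measure_cthickening_of_isCompact (μ := κ) hF).comp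
      radius_tendsto
    rw [κ_eq_zero] at tendsto_measure
    simpa only [zero_mul, Function.comp_apply] using
      ENNReal.Tendsto.mul_const tendsto_measure (Or.inr K_lt_top.ne)
  obtain ⟨n, energy_lt, mul_lt⟩ := ((frequently_lt_of_liminf_lt (by isBoundedDefault)
    hK).and_eventually (tendsto_mul.eventually_lt_const c_pos)).exists
  refine mul_lt.not_ge ((le_mul ν F hνF ((1 / 2 : ℝ) ^ n) (by positivity)).trans ?_)
  gcongr

end NeighbourhoodVolume

section Energy

variable {d M : ℕ} {T : Fin M → (E d →L[ℝ] E d)} {s t : ℝ} {μ : Measure (ℕ → Fin M)} {K : ℝ≥0∞}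

theorem tsum_mul_ofReal_pow_ne_top {C : ℝ≥0∞} (hC : C ≠ ∞) {q : ℝ} (hq : q < 1) :
    ∑' n : ℕ, C * ENNReal.ofReal q ^ n ≠ ∞ := by
  rw [ENNReal.tsum_mul_left, ENNReal.tsum_geometric]
  refine ENNReal.mul_ne_top hC (ENNReal.inv_ne_top.2 (tsub_pos_of_lt ?_).ne')
  exact ENNReal.ofReal_lt_one.2 hq

/-- The symbolic energy kernel `∑ φ^t(T_u)⁻¹`, summed over the common prefixes `u` of `v` and `w`.
It stands in for the paper's `φ^t(T_{v ∧ w})⁻¹`, which is the term of the longest such prefix. -/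
noncomputable def energyKernel (T : Fin M → (E d →L[ℝ] E d)) (t : ℝ) (v w : ℕ → Fin M) : ℝ≥0∞ :=
  ∑' n : ℕ, (cylinder (initWord v n)).indicator
    (fun _ => (ENNReal.ofReal (svf t (wordMap T (initWord v n))))⁻¹) w

theorem inv_svf_le_energyKernel (t : ℝ) {v w : ℕ → Fin M} {n : ℕ} (h : ∀ i < n, v i = w i) :
    (ENNReal.ofReal (svf t (wordMap T (initWord v n))))⁻¹ ≤ energyKernel T t v w := by
  refine le_trans ?_ (ENNReal.le_tsum n)
  rw [indicator_of_mem (mem_cylinder_initWord_iff.2 fun i hi => (h i hi).symm)]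

theorem energyKernel_self [NeZero d] (hT : ‖T‖ ≤ 1) (ht : 0 ≤ t) (v : ℕ → Fin M) :
    energyKernel T t v v = ∞ := by
  refine top_le_iff.1 ((ENNReal.tsum_const_eq_top_of_ne_zero (α := ℕ) one_ne_zero).symm.trans_le
    (ENNReal.tsum_le_tsum fun n => ?_))
  rw [indicator_of_mem (mem_cylinder_initWord v n), ENNReal.one_le_inv, ENNReal.ofReal_le_one]
  exact (svf_wordMap_le_pow T ht _).trans
    (pow_le_one₀ (by positivity) (Real.rpow_le_one (norm_nonneg T) hT ht))

theorem lintegral_energyKernel_le [NeZero d] (ht : 0 ≤ t) (hts : t ≤ s)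
    (hμ : ∀ u, μ (cylinder u) ≤ K * ENNReal.ofReal (svf s (wordMap T u))) (v : ℕ → Fin M) :
    ∫⁻ w, energyKernel T t v w ∂μ ≤ ∑' n : ℕ, K * ENNReal.ofReal (‖T‖ ^ (s - t)) ^ n := by
  have measurableSet_prefix (n : ℕ) : MeasurableSet (cylinder (initWord v n)) :=
    measurableSet_cylinder _
  simp only [energyKernel]
  rw [lintegral_tsum fun n =>
    (measurable_const.indicator (measurableSet_prefix n)).aemeasurable]
  refine ENNReal.tsum_le_tsum fun n => ?_
  rw [lintegral_indicator_const (measurableSet_prefix n), mul_comm, ← div_eq_mul_inv]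
  refine ENNReal.div_le_of_le_mul ((hμ _).trans ?_)
  rw [mul_assoc, ← ENNReal.ofReal_pow (by positivity), ← ENNReal.ofReal_mul (by positivity)]
  gcongr
  simpa only [length_initWord, mul_comm] using svf_wordMap_le T ht hts (initWord v n)

theorem exists_volume_norm_coding_sub_le_mul_energyKernel [NeZero d] (hdet : ∀ j, (T j).det ≠ 0)
    (hT : ‖T‖ < 1) {c : ℝ} (hc1 : c < 1) (hc : ∀ i j, i ≠ j → ‖T i‖ + ‖T j‖ ≤ c) {ρ : ℝ}
    (ht : 0 ≤ t) (htd : t ≤ d) (hρ : 1 ≤ ρ) :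
    ∃ C : ℝ≥0∞, C ≠ ∞ ∧ ∀ (v w : ℕ → Fin M) (r : ℝ), 0 < r →
      volume {a : Fin M → E d | ‖a‖ ≤ ρ ∧ ‖coding T a v - coding T a w‖ ≤ r} ≤
        C * ENNReal.ofReal (r ^ t) * energyKernel T t v w := by
  classical
  obtain ⟨C, hC, volume_le⟩ := exists_volume_norm_coding_sub_le hdet hT hc1 hc ht htd hρ
  refine ⟨C + 1, ENNReal.add_ne_top.2 ⟨hC, ENNReal.one_ne_top⟩, fun v w r hr => ?_⟩
  obtain rfl | hvw := eq_or_ne v w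
  · rw [energyKernel_self hT.le ht, ENNReal.mul_top]
    · exact le_top
    · exact mul_ne_zero (by simp) (ENNReal.ofReal_pos.2 (Real.rpow_pos_of_pos hr t)).ne'
  · have exists_ne := Function.ne_iff.1 hvw
    have common_prefix (i : ℕ) (hi : i < Nat.find exists_ne) : v i = w i :=
      not_not.1 (Nat.find_min exists_ne hi)
    refine (volume_le v w _ common_prefix (Nat.find_spec exists_ne) r hr.le).trans ?_
    rw [div_eq_mul_inv]
    gcongr
    · exact le_self_add
    · exact inv_svf_le_energyKernel t common_prefix

/-- The pairs of words whose images under the coding map are `r`-close. -/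
def closePairs (T : Fin M → (E d →L[ℝ] E d)) (a : Fin M → E d) (r : ℝ) :
    Set ((ℕ → Fin M) × (ℕ → Fin M)) :=
  {p | ‖coding T a p.1 - coding T a p.2‖ ≤ r}

theorem measurableSet_mem_closePairs (hT : ‖T‖ < 1) (r : ℝ) :
    MeasurableSet {x : (Fin M → E d) × ((ℕ → Fin M) × (ℕ → Fin M)) |
      x.2 ∈ closePairs T x.1 r} := by
  have continuous_left := (continuous_coding hT).comp
    (continuous_fst.prodMk (continuous_fst.comp continuous_snd) :
      Continuous fun x : (Fin M → E d) × ((ℕ → Fin M) × (ℕ → Fin M)) => (x.1, x.2.1))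
  have continuous_right := (continuous_coding hT).comp
    (continuous_fst.prodMk (continuous_snd.comp continuous_snd) :
      Continuous fun x : (Fin M → E d) × ((ℕ → Fin M) × (ℕ → Fin M)) => (x.1, x.2.2))
  exact (isClosed_le (continuous_left.sub continuous_right).norm continuous_const).measurableSet

theorem measurable_measure_closePairs (hT : ‖T‖ < 1)
    (m : Measure ((ℕ → Fin M) × (ℕ → Fin M))) [SFinite m] (r : ℝ) :
    Measurable fun a => m (closePairs T a r) :=
  measurable_measure_prodMk_left (measurableSet_mem_closePairs hT r)

theorem exists_setLIntegral_closePairs_le [NeZero d] (hdet : ∀ j, (T j).det ≠ 0) (hT : ‖T‖ < 1)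
    {c : ℝ} (hc1 : c < 1) (hc : ∀ i j, i ≠ j → ‖T i‖ + ‖T j‖ ≤ c) {ρ : ℝ} (ht : 0 ≤ t)
    (htd : t ≤ d) (hts : t < s) (hρ : 1 ≤ ρ) [IsFiniteMeasure μ] (hK : K ≠ ∞)
    (hμ : ∀ u, μ (cylinder u) ≤ K * ENNReal.ofReal (svf s (wordMap T u))) :
    ∃ C : ℝ≥0∞, C ≠ ∞ ∧ ∀ r : ℝ, 0 < r →
      ∫⁻ a in Metric.closedBall (0 : Fin M → E d) ρ, μ.prod μ (closePairs T a r) ≤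
        C * ENNReal.ofReal (r ^ t) := by
  obtain ⟨C, hC, volume_le⟩ :=
    exists_volume_norm_coding_sub_le_mul_energyKernel hdet hT hc1 hc ht htd hρ
  set B := ∑' n : ℕ, K * ENNReal.ofReal (‖T‖ ^ (s - t)) ^ n
  have hB : B ≠ ∞ := tsum_mul_ofReal_pow_ne_top hK
    (Real.rpow_lt_one (norm_nonneg T) hT (sub_pos.2 hts))
  refine ⟨C * (B * μ univ), ENNReal.mul_ne_top hC (ENNReal.mul_ne_top hB (measure_ne_top μ univ)),
    fun r hr => ?_⟩
  have measurableSet_close := measurableSet_mem_closePairs hT r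
  have hCr : C * ENNReal.ofReal (r ^ t) ≠ ∞ := ENNReal.mul_ne_top hC ENNReal.ofReal_ne_top
  calc ∫⁻ a in Metric.closedBall (0 : Fin M → E d) ρ, μ.prod μ (closePairs T a r)
      = ∫⁻ p, (volume.restrict (Metric.closedBall 0 ρ))
          {a : Fin M → E d | p ∈ closePairs T a r} ∂μ.prod μ :=
        (Measure.prod_apply measurableSet_close).symm.trans
          (Measure.prod_apply_symm measurableSet_close)
    _ = ∫⁻ v, ∫⁻ w, (volume.restrict (Metric.closedBall 0 ρ))
          {a : Fin M → E d | (v, w) ∈ closePairs T a r} ∂μ ∂μ :=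
        lintegral_prod _ (measurable_measure_prodMk_right measurableSet_close).aemeasurable
    _ ≤ ∫⁻ v, ∫⁻ w, C * ENNReal.ofReal (r ^ t) * energyKernel T t v w ∂μ ∂μ := by
        refine lintegral_mono fun v => lintegral_mono fun w => ?_
        refine le_trans ?_ (volume_le v w r hr)
        rw [Measure.restrict_apply' Metric.isClosed_closedBall.measurableSet]
        exact measure_mono fun a ha => ⟨mem_closedBall_zero_iff.1 ha.2, ha.1⟩
    _ ≤ ∫⁻ _, C * ENNReal.ofReal (r ^ t) * B ∂μ := by
        refine lintegral_mono fun v => ?_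
        rw [lintegral_const_mul' _ _ hCr]
        gcongr
        exact lintegral_energyKernel_le ht hts.le hμ v
    _ = C * (B * μ univ) * ENNReal.ofReal (r ^ t) := by
        rw [lintegral_const]
        ring

theorem ae_of_forall_ae_restrict_closedBall {V : Type*} [SeminormedAddCommGroup V]
    [MeasurableSpace V] {κ : Measure V} {P : V → Prop}
    (h : ∀ ρ : ℝ, 1 ≤ ρ → ∀ᵐ a ∂κ.restrict (Metric.closedBall 0 ρ), P a) : ∀ᵐ a ∂κ, P a := by
  rw [← κ.restrict_univ, ← Metric.iUnion_closedBall_nat 0, ae_restrict_iUnion_iff]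
  exact fun n => ae_restrict_of_ae_restrict_of_subset
    (Metric.closedBall_subset_closedBall (by simp)) (h (n + 1) (by simp))

theorem lintegral_map_closedBall (hT : ‖T‖ < 1) (a : Fin M → E d) (μ : Measure (ℕ → Fin M))
    [IsFiniteMeasure μ] (r : ℝ) :
    ∫⁻ x, μ.map (coding T a) (Metric.closedBall x r) ∂μ.map (coding T a) =
      μ.prod μ (closePairs T a r) := by
  have measurable_coding := (continuous_coding_right hT a).measurable
  rw [lintegral_map (measurable_measure_closedBall _ r) measurable_coding, Measure.prod_apply]
  · refine lintegral_congr fun v => ?_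
    rw [Measure.map_apply measurable_coding Metric.isClosed_closedBall.measurableSet]
    congr 1
    ext w
    simp only [mem_preimage, Metric.mem_closedBall', closePairs, mem_ofPred_eq, dist_eq_norm]
  · exact (measurable_prodMk_left (x := a)) (measurableSet_mem_closePairs hT r)

theorem measurableSet_range_coding (hT : ‖T‖ < 1) (a : Fin M → E d) :
    MeasurableSet (range (coding T a)) :=
  (isCompact_range (continuous_coding_right hT a)).isClosed.measurableSet

theorem map_coding_range (hT : ‖T‖ < 1) (a : Fin M → E d) (μ : Measure (ℕ → Fin M)) :
    μ.map (coding T a) (range (coding T a)) = μ univ := by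
  rw [Measure.map_apply (continuous_coding_right hT a).measurable (measurableSet_range_coding hT a),
    preimage_range]

theorem tsum_div_ofReal_rpow_ne_top {g : ℝ → ℝ≥0∞} {C : ℝ≥0∞} (hC : C ≠ ∞)
    (hg : ∀ r, 0 < r → g r ≤ C * ENNReal.ofReal (r ^ t)) (hst : s < t) :
    ∑' n : ℕ, g ((1 / 2 : ℝ) ^ n) / ENNReal.ofReal (((1 / 2 : ℝ) ^ n) ^ s) ≠ ∞ := by
  refine ne_top_of_le_ne_top (tsum_mul_ofReal_pow_ne_top hC (q := (1 / 2 : ℝ) ^ (t - s))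
    (Real.rpow_lt_one (by norm_num) (by norm_num) (sub_pos.2 hst)))
    (ENNReal.tsum_le_tsum fun n => ?_)
  have hr : (0 : ℝ) < (1 / 2) ^ n := by positivity
  refine (ENNReal.div_le_div_right (hg _ hr) _).trans_eq ?_
  rw [mul_div_assoc, ← ENNReal.ofReal_div_of_pos (by positivity), ← Real.rpow_sub hr,
    ← ENNReal.ofReal_pow (by positivity), Real.rpow_pow_comm (by norm_num)]

theorem ae_le_dimH_range_coding [NeZero d] [Nonempty (Fin M)] (hdet : ∀ j, (T j).det ≠ 0)
    (hT : ‖T‖ < 1) {c : ℝ} (hc1 : c < 1) (hc : ∀ i j, i ≠ j → ‖T i‖ + ‖T j‖ ≤ c)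
    (hsd : sA T ≤ d) (hs : 0 ≤ s) (hsA : s < sA T) :
    ∀ᵐ a : Fin M → E d, ENNReal.ofReal s ≤ dimH (range (coding T a)) := by
  obtain ⟨t', hst', ht'A⟩ := exists_between hsA
  obtain ⟨t, hst, htt'⟩ := exists_between hst'
  obtain ⟨μ, _, K, hK, hμ⟩ := exists_frostman_measure hdet hT (hs.trans hst'.le) ht'A
  refine ae_of_forall_ae_restrict_closedBall fun ρ hρ => ?_
  obtain ⟨C, hC, setLIntegral_le⟩ := exists_setLIntegral_closePairs_le hdet hT hc1 hc
    (hs.trans hst.le) ((htt'.trans ht'A).le.trans hsd) htt' hρ hK hμ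
  have measurable_term (n : ℕ) : Measurable fun a : Fin M → E d =>
      μ.prod μ (closePairs T a ((1 / 2 : ℝ) ^ n)) / ENNReal.ofReal (((1 / 2 : ℝ) ^ n) ^ s) :=
    (measurable_measure_closePairs hT _ _).div_const _
  have lintegral_energy_ne_top : ∫⁻ a in Metric.closedBall (0 : Fin M → E d) ρ, ∑' n : ℕ,
      μ.prod μ (closePairs T a ((1 / 2 : ℝ) ^ n)) /
        ENNReal.ofReal (((1 / 2 : ℝ) ^ n) ^ s) ≠ ∞ := by
    rw [lintegral_tsum fun n => (measurable_term n).aemeasurable]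
    simp only [div_eq_mul_inv _ (ENNReal.ofReal _),
      lintegral_mul_const _ (measurable_measure_closePairs hT _ _)]
    exact tsum_div_ofReal_rpow_ne_top hC setLIntegral_le hst
  filter_upwards [ae_lt_top (Measurable.tsum measurable_term) lintegral_energy_ne_top] with a ha
  refine le_dimH_of_tsum_lintegral_closedBall_ne_top (ν := μ.map (coding T a))
    (measurableSet_range_coding hT a) ?_ hs ?_
  · simp [map_coding_range hT]
  · simpa only [lintegral_map_closedBall hT] using ha.ne

theorem ae_dimH_range_coding_eq [NeZero d] [Nontrivial (Fin M)] (hdet : ∀ j, (T j).det ≠ 0)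
    (hT : ‖T‖ < 1) {c : ℝ} (hc1 : c < 1) (hc : ∀ i j, i ≠ j → ‖T i‖ + ‖T j‖ ≤ c)
    (hsd : sA T ≤ d) :
    ∀ᵐ a : Fin M → E d, dimH (range (coding T a)) = ENNReal.ofReal (sA T) := by
  obtain ⟨u, -, hu, tendsto_u⟩ := exists_seq_strictMono_tendsto' (sA_pos hdet hT)
  have le_dimH : ∀ᵐ a : Fin M → E d, ∀ n, ENNReal.ofReal (u n) ≤ dimH (range (coding T a)) :=
    ae_all_iff.2 fun n => ae_le_dimH_range_coding hdet hT hc1 hc hsd (hu n).1.le (hu n).2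
  filter_upwards [le_dimH] with a ha
  exact (dimH_range_coding_le hdet hT hsd a).antisymm
    (le_of_tendsto' (ENNReal.tendsto_ofReal tendsto_u) ha)

theorem ae_volume_range_coding_pos [NeZero d] [Nonempty (Fin M)] (hdet : ∀ j, (T j).det ≠ 0)
    (hT : ‖T‖ < 1) {c : ℝ} (hc1 : c < 1) (hc : ∀ i j, i ≠ j → ‖T i‖ + ‖T j‖ ≤ c)
    (hsd : (d : ℝ) < sA T) : ∀ᵐ a : Fin M → E d, 0 < volume (range (coding T a)) := by
  obtain ⟨s, hds, hsA⟩ := exists_between hsd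
  obtain ⟨μ, _, K, hK, hμ⟩ := exists_frostman_measure hdet hT (d.cast_nonneg.trans hds.le) hsA
  refine ae_of_forall_ae_restrict_closedBall fun ρ hρ => ?_
  obtain ⟨C, hC, setLIntegral_le⟩ := exists_setLIntegral_closePairs_le hdet hT hc1 hc
    d.cast_nonneg le_rfl hds hρ hK hμ
  have measurable_term (n : ℕ) : Measurable fun a : Fin M → E d =>
      μ.prod μ (closePairs T a ((1 / 2 : ℝ) ^ n)) / ENNReal.ofReal (((1 / 2 : ℝ) ^ n) ^ d) :=
    (measurable_measure_closePairs hT _ _).div_const _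
  have lintegral_liminf_ne_top : ∫⁻ a in Metric.closedBall (0 : Fin M → E d) ρ,
      liminf (fun n : ℕ => μ.prod μ (closePairs T a ((1 / 2 : ℝ) ^ n)) /
        ENNReal.ofReal (((1 / 2 : ℝ) ^ n) ^ d)) atTop ≠ ∞ := by
    refine ne_top_of_le_ne_top hC ((lintegral_liminf_le measurable_term).trans ?_)
    refine liminf_le_of_frequently_le' (Frequently.of_forall fun n => ?_)
    simp only [div_eq_mul_inv _ (ENNReal.ofReal _)]
    rw [lintegral_mul_const _ (measurable_measure_closePairs hT _ _), ← div_eq_mul_inv]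
    refine ENNReal.div_le_of_le_mul ?_
    simpa only [Real.rpow_natCast] using setLIntegral_le ((1 / 2 : ℝ) ^ n) (by positivity)
  filter_upwards [ae_lt_top (Measurable.liminf measurable_term) lintegral_liminf_ne_top] with a ha
  have : IsProbabilityMeasure (μ.map (coding T a)) := Measure.isProbabilityMeasure_map
    (continuous_coding_right hT a).measurable.aemeasurable
  refine measure_pos_of_liminf_lintegral_closedBall_lt_top volume (ν := μ.map (coding T a))
    (isCompact_range (continuous_coding_right hT a)) ?_ ?_
  · rw [prob_compl_eq_zero_iff (measurableSet_range_coding hT a), map_coding_range hT, measure_univ]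
  · simpa only [lintegral_map_closedBall hT, finrank_euclideanSpace_fin] using ha

end Energy

section NormBounds

variable {d M : ℕ} {T : Fin M → (E d →L[ℝ] E d)}

theorem norm_lt_one_of_forall_norm_add_norm_lt_one [Nontrivial (Fin M)]
    (h : ∀ i j, i ≠ j → ‖T i‖ + ‖T j‖ < 1) : ‖T‖ < 1 :=
  (pi_norm_lt_iff one_pos).2 fun i =>
    let ⟨j, hij⟩ := exists_ne i
    (le_add_of_nonneg_right (norm_nonneg (T j))).trans_lt (h i j hij.symm)

theorem exists_lt_one_forall_norm_add_norm_le (h : ∀ i j, i ≠ j → ‖T i‖ + ‖T j‖ < 1) :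
    ∃ c < 1, ∀ i j, i ≠ j → ‖T i‖ + ‖T j‖ ≤ c := by
  obtain hempty | hnonempty := isEmpty_or_nonempty {p : Fin M × Fin M // p.1 ≠ p.2}
  · exact ⟨0, one_pos, fun i j hij => hempty.elim ⟨(i, j), hij⟩⟩
  · obtain ⟨p, hp⟩ := Finite.exists_max fun p : {p : Fin M × Fin M // p.1 ≠ p.2} =>
      ‖T p.1.1‖ + ‖T p.1.2‖
    exact ⟨_, h _ _ p.2, fun i j hij => hp ⟨(i, j), hij⟩⟩

end NormBounds

end SelfAffine

theorem mainTheorem11_general (d M : ℕ) (hd : 1 ≤ d) (hM : 2 ≤ M)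
    (T : Fin M → (SelfAffine.E d →L[ℝ] SelfAffine.E d))
    (hT_nonsing : ∀ j, (T j).det ≠ 0) (hT_norm : ∀ i j, i ≠ j → ‖T i‖ + ‖T j‖ < 1) :
    IsGLB {s : ℝ | 0 ≤ s ∧ SelfAffine.netMeasure T s univ = 0} (SelfAffine.sA T) ∧
    IsLUB {s : ℝ | 0 ≤ s ∧ SelfAffine.netMeasure T s univ = ∞} (SelfAffine.sA T) ∧
    (∀ s : ℝ, SelfAffine.IsAffinityDim T s ↔ s = SelfAffine.sA T) ∧
    (∀ a : Fin M → SelfAffine.E d, ∃! F : Set (SelfAffine.E d), SelfAffine.IsAttractor T a F) ∧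
    ∀ᵐ a : Fin M → SelfAffine.E d, ∀ F : Set (SelfAffine.E d), SelfAffine.IsAttractor T a F →
      (SelfAffine.sA T ≤ d → dimH F = ENNReal.ofReal (SelfAffine.sA T)) ∧
      ((d : ℝ) < SelfAffine.sA T → 0 < (volume : Measure (SelfAffine.E d)) F) := by
  have : NeZero d := ⟨by omega⟩
  have : Nontrivial (Fin M) := Fin.nontrivial_iff_two_le.2 hM
  have hT := SelfAffine.norm_lt_one_of_forall_norm_add_norm_lt_one hT_norm
  obtain ⟨c, hc1, hc⟩ := SelfAffine.exists_lt_one_forall_norm_add_norm_le hT_norm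
  refine ⟨SelfAffine.isGLB_sA hT_nonsing hT, SelfAffine.isLUB_sA hT_nonsing hT,
    fun _ => SelfAffine.isAffinityDim_iff hT_nonsing hT, fun a => ⟨_,
    SelfAffine.isAttractor_range_coding hT a, fun F hF => hF.eq_range_coding hT⟩, ?_⟩
  obtain hle | hlt := le_or_gt (SelfAffine.sA T) d
  · filter_upwards [SelfAffine.ae_dimH_range_coding_eq hT_nonsing hT hc1 hc hle] with a ha F hF
    rw [hF.eq_range_coding hT]
    exact ⟨fun _ => ha, fun hlt => absurd hle hlt.not_ge⟩
  · filter_upwards [SelfAffine.ae_volume_range_coding_pos hT_nonsing hT hc1 hc hlt] with a ha F hF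
    rw [hF.eq_range_coding hT]
    exact ⟨fun hle => absurd hle hlt.not_ge, fun _ => ha⟩

theorem mainTheorem11 (d M : ℕ) (hd : 1 ≤ d) (hM : 2 ≤ M)
    (T : Fin M → (SelfAffine.E d →L[ℝ] SelfAffine.E d))
    (hT_nonsing : ∀ j, (T j).det ≠ 0) (hT_norm : ∀ j, ‖T j‖ < 1 / 2) :
    -- the critical value `s_A` is well defined, from either side
    IsGLB {s : ℝ | 0 ≤ s ∧ SelfAffine.netMeasure T s univ = 0} (SelfAffine.sA T) ∧
    IsLUB {s : ℝ | 0 ≤ s ∧ SelfAffine.netMeasure T s univ = ∞} (SelfAffine.sA T) ∧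
    -- it is the affinity dimension
    (∀ s : ℝ, SelfAffine.IsAffinityDim T s ↔ s = SelfAffine.sA T) ∧
    -- every translation vector determines a self-affine set
    (∀ a : Fin M → SelfAffine.E d, ∃! F : Set (SelfAffine.E d), SelfAffine.IsAttractor T a F) ∧
    -- and for almost every translation vector its size is given by `s_A`
    ∀ᵐ a : Fin M → SelfAffine.E d, ∀ F : Set (SelfAffine.E d), SelfAffine.IsAttractor T a F →
      (SelfAffine.sA T ≤ d → dimH F = ENNReal.ofReal (SelfAffine.sA T)) ∧
      ((d : ℝ) < SelfAffine.sA T → 0 < (volume : Measure (SelfAffine.E d)) F) :=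
  mainTheorem11_general d M hd hM T hT_nonsing fun i j _ => by
    linarith [hT_norm i, hT_norm j]
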